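/- There are absolute constants $c, c_1, c_2 > 0$ such that the following holds for every randomized memoryless routing algorithm $\mathcal{A}$ and every integer $k > 0$: there is a convex subdivision $G = (V,E)$ with $c_1 k \le |V| \le c_2 k$, and there are vertices $s, t \in V$, such that the expected number of steps that $\mathcal{A}$ takes to route from $s$ to $t$ on $G$ is at least $c k^2$ (possibly infinite). Here a geometric graph is a finite simple graph $G=(V,E)$ with $V\subset\mathbb{R}^2$ whose edges are drawn as straight segments; its faces are the connected components of the complement in $\mathbb{R}^2$ of the union of its vertices and edges. A convex subdivision is a connected geometric graph in which no edge contains a vertex other than its endpoints and two distinct edges meet at most in a common endpoint, whose bounded faces are interiors of convex polygons, and whose unbounded face is the complement of a convex polygon (convex polygons have nonempty interior; vertices of $G$ may lie in the relative interiors of the sides of these polygons). A randomized memoryless routing algorithm is a function $f$ that maps a current position $v\in\mathbb{R}^2$, a destination $t\in\mathbb{R}^2$, a finite nonempty set $N\subset\mathbb{R}^2$ (the neighbourhood of $v$) and an infinite bit sequence $B\in\{0,1\}^{\infty}$ to a point of $\mathbb{R}^2$, measurably in $B$, with $f(v,t,N,B)\in N$ if $v\ne t$, and $f(t,t,N,B)=t$.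 Routing from $s$ to $t$ on $G$ means $X_0=s$ and $X_{i+1}=f(X_i,t,N(X_i),B_i)$, where $N(v)$ is the set of neighbours of $v$ in $G$ and $B_0,B_1,\dots$ are independent sequences of independent fair bits; the number of steps is $\min\{n\ge 0 : X_n=t\}$, or $\infty$ if $t$ is never reached. -/

import Mathlib

open MeasureTheory
open scoped ENNReal

namespace GeoRouting

/-- The Euclidean plane. -/
abbrev Plane : Type := EuclideanSpace ℝ (Fin 2)

/-- A (finite, simple) geometric graph: its vertices are points of the plane; an edge `u v` is drawn
as the straight segment from `u` to `v`. -/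
structure GeometricGraph where
  verts : Finset Plane
  graph : SimpleGraph Plane
  adj_mem : ∀ u v, graph.Adj u v → u ∈ verts ∧ v ∈ verts

namespace GeometricGraph

open Classical in
/-- The neighbourhood `N(v)`, as a finite set of points of the plane. -/
noncomputable def nbrs (G : GeometricGraph) (v : Plane) : Finset Plane :=
  G.verts.filter (fun w => G.graph.Adj v w)

/-- The set of points of the plane covered by the vertices and the edges. -/
def drawing (G : GeometricGraph) : Set Plane :=
  (G.verts : Set Plane) ∪ {x | ∃ u v, G.graph.Adj u v ∧ x ∈ segment ℝ u v}

/-- The faces are the connected components of the complement of the drawing. -/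
def IsFace (G : GeometricGraph) (F : Set Plane) : Prop :=
  ∃ x ∈ G.drawingᶜ, F = connectedComponentIn G.drawingᶜ x

/-- No edge passes through a vertex other than its endpoints, and two different edges meet at most
in a common endpoint. -/
def IsPlane (G : GeometricGraph) : Prop :=
  (∀ u v w, G.graph.Adj u v → w ∈ G.verts → w ∈ segment ℝ u v → w = u ∨ w = v) ∧
  (∀ u v x y, G.graph.Adj u v → G.graph.Adj x y → s(u, v) ≠ s(x, y) →
    segment ℝ u v ∩ segment ℝ x y ⊆ ({u, v} : Set Plane) ∩ {x, y})

end GeometricGraph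

/-- A (closed, nondegenerate) convex polygon: the convex hull of finitely many points, with nonempty
interior. -/
def IsConvexPolygon (P : Set Plane) : Prop :=
  (∃ S : Finset Plane, P = convexHull ℝ (S : Set Plane)) ∧ (interior P).Nonempty

/-- A convex subdivision: a connected plane geometric graph whose bounded faces are (the interiors
of) convex polygons and whose unbounded face is the complement of a convex polygon. Vertices may lie
in the relative interior of a side of such a polygon. -/
structure GeometricGraph.IsConvexSubdivision (G : GeometricGraph) : Prop where
  isPlane : G.IsPlane
  connected : ∀ u ∈ G.verts, ∀ v ∈ G.verts, G.graph.Reachable u v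
  inner_face : ∀ F, G.IsFace F → Bornology.IsBounded F →
    ∃ P, IsConvexPolygon P ∧ F = interior P
  outer_face : ∀ F, G.IsFace F → ¬ Bornology.IsBounded F →
    ∃ P, IsConvexPolygon P ∧ F = Pᶜ

/-- Infinite sequences of bits. -/
abbrev Bits : Type := ℕ → Bool

/-- The law of a sequence of independent fair random bits. -/
noncomputable def fairBits : Measure Bits :=
  Measure.infinitePi (fun _ : ℕ => (PMF.uniformOfFintype Bool).toMeasure)

instance : IsProbabilityMeasure fairBits := by
  unfold fairBits; infer_instance

/-- A randomized memoryless routing algorithm: `step v t N B` is the next position of a packet that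
is at `v`, has destination `t`, sees the neighbourhood `N` of `v`, and is given the random bits
`B`. -/
structure MemorylessAlgorithm where
  step : Plane → Plane → Finset Plane → Bits → Plane
  step_mem : ∀ v t N B, v ≠ t → N.Nonempty → step v t N B ∈ N
  step_target : ∀ t N B, step t t N B = t
  measurable_step : ∀ v t N, N.Nonempty → Measurable (step v t N)

namespace MemorylessAlgorithm

/-- The position after `n` steps when routing from `s` to `t` on `G`; `ω i` is the sequence of fresh
random bits that is used in step `i`. -/
noncomputable def position (A : MemorylessAlgorithm) (G : GeometricGraph) (s t : Plane)
    (ω : ℕ → Bits) : ℕ → Plane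
  | 0 => s
  | n + 1 => A.step (A.position G s t ω n) t (G.nbrs (A.position G s t ω n)) (ω n)

/-- The number of steps until `t` is reached (`∞` if it never is). -/
noncomputable def numSteps (A : MemorylessAlgorithm) (G : GeometricGraph) (s t : Plane)
    (ω : ℕ → Bits) : ℝ≥0∞ :=
  ⨅ (n : ℕ) (_ : A.position G s t ω n = t), (n : ℝ≥0∞)

/-- The expected number of steps taken to route from `s` to `t` on `G`, the bit sequences of
different steps being independent. -/
noncomputable def expectedSteps (A : MemorylessAlgorithm) (G : GeometricGraph) (s t : Plane) :
    ℝ≥0∞ :=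
  ∫⁻ ω, A.numSteps G s t ω ∂(Measure.infinitePi (fun _ : ℕ => fairBits))

end MemorylessAlgorithm

end GeoRouting

/-!
The lower bound comes from the commute time of a birth-death chain. Consider a straight path that is
divided into `k` edges, an *arm*. A vertex in its interior sees nothing but its two neighbours, so
there the algorithm performs a fixed nearest-neighbour walk, whatever the rest of the graph is.
Whatever the transition probabilities are, the expected times to cross the arm in its two
directions, with a reflecting starting point, add up to at least `2 k ^ 2`: the sum is twice the
product of the total resistance and the total conductance, and Cauchy-Schwarz applies
(`isSlow_or_isSlow_reverse`). So every arm that misses the target is slow in at least one of its two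
directions. If all edges joining a set `S` of vertices to the rest of a graph belong to arms that
are slow when left at the end in `S`, then routing from `S` to a target outside `S` takes at least
`k ^ 2` expected steps (`Frame.Proper.ofReal_sq_le_expectedSteps`); the certificate is a potential
that drops by at most one per step in expectation.

It remains to find, for every choice of slow directions, a convex subdivision that uses slow arms
only. The target is the origin. Take a triangle around it with corners `s 0`, `s 1`, `s 2`, and
prolong each side at both ends: the arm `F i` prolongs the side `s (i - 1) s i` beyond `s i`, and
the arm `M i` prolongs the side `s (i + 1) s i` beyond `s i`. These six arms suffice:

* if `M i` and `F (i + 1)`, which lie on one line, are both slow when left at their inner ends, the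
  triangle spanned by them and the origin works (`hasSlowGraph_triangle`);
* if `F i` and `M (i + 1)` are both slow when left at their outer ends, the pentagon spanned by them
  and the origin works (`hasSlowGraph_pentagon`);
* if all `F i` are slow when left at their outer ends, they join the inner triangle to an outer one
  in the shape of a pinwheel, with convex faces (`hasSlowGraph_pinwheel`); the same holds for the
  `M i`, in the mirror image.

If some `F i` is not slow when left at its outer end, it is slow when left at its inner end, so by
the first item `M (i - 1)` is slow when left at its outer end, so by the second item `F (i - 2)`,
which is `F (i + 1)`, is not slow when left at its outer end. Going around, all `M i` are slow when
left at their outer ends, and the mirror image of the pinwheel works.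
-/

namespace GeoRouting

/-! ### Potentials bound the expected routing time from below -/

lemma GeometricGraph.nbrs_subset (G : GeometricGraph) (v : Plane) : G.nbrs v ⊆ G.verts := by
  classical
  exact Finset.filter_subset _ _

namespace MemorylessAlgorithm

variable (A : MemorylessAlgorithm)

/-- The probability that the algorithm, standing at `v` with destination `t` and neighbourhood `N`,
moves to `w`. -/
noncomputable def moveProb (t v : Plane) (N : Finset Plane) (w : Plane) : ℝ :=
  fairBits.real {B | A.step v t N B = w}

lemma moveProb_nonneg (t v : Plane) (N : Finset Plane) (w : Plane) : 0 ≤ A.moveProb t v N w :=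
  measureReal_nonneg

lemma measurableSet_step (t v : Plane) {N : Finset Plane} (hN : N.Nonempty) (w : Plane) :
    MeasurableSet {B | A.step v t N B = w} :=
  A.measurable_step v t N hN (measurableSet_singleton w)

lemma measurableSet_step_eval (t v : Plane) {N : Finset Plane} (hN : N.Nonempty) (w : Plane)
    (n : ℕ) : MeasurableSet {ω : ℕ → Bits | A.step v t N (ω n) = w} :=
  ((A.measurable_step v t N hN).comp (measurable_pi_apply n)) (measurableSet_singleton w)

lemma sum_moveProb {t v : Plane} {N : Finset Plane} (hN : N.Nonempty) (hv : v ≠ t) :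
    ∑ w ∈ N, A.moveProb t v N w = 1 := by
  unfold moveProb
  rw [← measureReal_biUnion_finset]
  · have : (⋃ w ∈ N, {B | A.step v t N B = w}) = Set.univ := by
      ext B
      simpa using A.step_mem v t N B hv hN
    rw [this]
    simp
  · intro w _ w' _ hww'
    exact Set.disjoint_left.2 fun B h h' => hww' (h.symm.trans h')
  · exact fun w _ => A.measurableSet_step t v hN w

variable (G : GeometricGraph)

lemma position_mem (hN : ∀ v ∈ G.verts, (G.nbrs v).Nonempty) {s : Plane} (hs : s ∈ G.verts)
    (t : Plane) (ω : ℕ → Bits) (n : ℕ) : A.position G s t ω n ∈ G.verts := by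
  induction n with
  | zero => exact hs
  | succ n ih =>
    rw [position]
    by_cases h : A.position G s t ω n = t
    · rw [h, A.step_target, ← h]
      exact ih
    · exact G.nbrs_subset _ (A.step_mem _ t _ (ω n) h (hN _ ih))

lemma position_congr (s t : Plane) {ω ω' : ℕ → Bits} (n : ℕ) (h : ∀ i < n, ω i = ω' i) :
    A.position G s t ω n = A.position G s t ω' n := by
  induction n with
  | zero => rfl
  | succ n ih =>
    rw [position, position, ih fun i hi => h i (by omega), h n (by omega)]

lemma position_eq_target_of_le {s t : Plane} {ω : ℕ → Bits} {m n : ℕ} (hmn : m ≤ n)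
    (h : A.position G s t ω m = t) : A.position G s t ω n = t := by
  induction n, hmn using Nat.le_induction with
  | base => exact h
  | succ n _ ih => rw [position, ih, A.step_target]

variable {G}

lemma setOf_position_succ (hN : ∀ v ∈ G.verts, (G.nbrs v).Nonempty) {s : Plane}
    (hs : s ∈ G.verts) (t w : Plane) (n : ℕ) :
    {ω | A.position G s t ω (n + 1) = w} = ⋃ v ∈ G.verts,
      {ω | A.position G s t ω n = v} ∩ {ω | A.step v t (G.nbrs v) (ω n) = w} := by
  ext ω
  simp only [position, Set.mem_ofPred_eq, Set.mem_iUnion, Set.mem_inter_iff, exists_prop]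
  constructor
  · intro h
    exact ⟨_, A.position_mem G hN hs t ω n, rfl, h⟩
  · rintro ⟨v, -, rfl, h⟩
    exact h

lemma measurableSet_position (hN : ∀ v ∈ G.verts, (G.nbrs v).Nonempty) {s : Plane}
    (hs : s ∈ G.verts) (t : Plane) (n : ℕ) (v : Plane) :
    MeasurableSet {ω | A.position G s t ω n = v} := by
  induction n generalizing v with
  | zero =>
    by_cases h : s = v <;> simp [position, h]
  | succ n ih =>
    rw [A.setOf_position_succ hN hs]
    refine Finset.measurableSet_biUnion _ fun u hu => (ih u).inter ?_
    exact A.measurableSet_step_eval t u (hN u hu) v n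

/-- The law of the random bits of all steps. -/
noncomputable abbrev runLaw : Measure (ℕ → Bits) := Measure.infinitePi fun _ : ℕ => fairBits

/-- The position after `n` steps depends on the bits of the first `n` steps only, so it is
independent of the bits of the next step. -/
lemma runLaw_position_inter_step (hN : ∀ v ∈ G.verts, (G.nbrs v).Nonempty) {s : Plane}
    (hs : s ∈ G.verts) (t : Plane) (n : ℕ) {v : Plane} (hv : v ∈ G.verts) (w : Plane) :
    runLaw.real ({ω | A.position G s t ω n = v} ∩ {ω | A.step v t (G.nbrs v) (ω n) = w}) =
      runLaw.real {ω | A.position G s t ω n = v} * A.moveProb t v (G.nbrs v) w := by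
  have hind : ProbabilityTheory.iIndepFun (fun (i : ℕ) (ω : ℕ → Bits) => ω i) runLaw :=
    ProbabilityTheory.iIndepFun_infinitePi (P := fun _ : ℕ => fairBits)
      (X := fun _ B => B) fun _ => measurable_id
  have h := hind.indepFun_finset (Finset.range n) {n} (by simp) fun i => measurable_pi_apply i
  let ext : ((i : Finset.range n) → Bits) → ℕ → Bits := fun y i =>
    if hi : i ∈ Finset.range n then y ⟨i, hi⟩ else fun _ => false
  have hext : Measurable ext := by
    refine measurable_pi_lambda _ fun i => ?_
    by_cases hi : i ∈ Finset.range n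
    · simpa only [ext, hi, dite_true] using measurable_pi_apply _
    · simp only [ext, hi, dite_false]
      exact measurable_const
  have h1 : {ω | A.position G s t ω n = v} =
      (fun (a : ℕ → Bits) (i : Finset.range n) => a i) ⁻¹'
        (ext ⁻¹' {ω | A.position G s t ω n = v}) := by
    ext ω
    simp only [Set.mem_ofPred_eq, Set.mem_preimage]
    rw [A.position_congr G s t n (ω' := ext fun i => ω i) fun i hi => by simp [ext, hi]]
  have h2 : {ω : ℕ → Bits | A.step v t (G.nbrs v) (ω n) = w} =
      (fun (a : ℕ → Bits) (i : ({n} : Finset ℕ)) => a i) ⁻¹'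
        ((fun y => y ⟨n, by simp⟩) ⁻¹' {B | A.step v t (G.nbrs v) B = w}) := rfl
  have hstep := A.measurableSet_step t v (hN v hv) w
  have key := h.measure_inter_preimage_eq_mul _ _
    (hext (A.measurableSet_position hN hs t n v))
    ((measurable_pi_apply (⟨n, by simp⟩ : ({n} : Finset ℕ))) hstep)
  rw [← h1, ← h2] at key
  have h3 : runLaw {ω : ℕ → Bits | A.step v t (G.nbrs v) (ω n) = w} =
      fairBits {B | A.step v t (G.nbrs v) B = w} :=
    (measurePreserving_eval_infinitePi (fun _ : ℕ => fairBits) n).measure_preimage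
      hstep.nullMeasurableSet
  rw [measureReal_def, key, h3, ENNReal.toReal_mul]
  rfl

lemma runLaw_position_succ (hN : ∀ v ∈ G.verts, (G.nbrs v).Nonempty) {s : Plane}
    (hs : s ∈ G.verts) (t : Plane) (n : ℕ) (w : Plane) :
    runLaw.real {ω | A.position G s t ω (n + 1) = w} =
      ∑ v ∈ G.verts, runLaw.real {ω | A.position G s t ω n = v} *
        A.moveProb t v (G.nbrs v) w := by
  rw [A.setOf_position_succ hN hs, measureReal_biUnion_finset]
  · exact Finset.sum_congr rfl fun v hv => A.runLaw_position_inter_step hN hs t n hv w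
  · intro v _ v' _ hvv'
    exact Set.disjoint_left.2 fun ω h h' => hvv' (h.1.symm.trans h'.1)
  · intro v hv
    exact (A.measurableSet_position hN hs t n v).inter
      (A.measurableSet_step_eval t v (hN v hv) w n)

lemma sum_runLaw_position (hN : ∀ v ∈ G.verts, (G.nbrs v).Nonempty) {s : Plane}
    (hs : s ∈ G.verts) (t : Plane) (n : ℕ) :
    ∑ v ∈ G.verts, runLaw.real {ω | A.position G s t ω n = v} = 1 := by
  rw [← measureReal_biUnion_finset]
  · have : (⋃ v ∈ G.verts, {ω | A.position G s t ω n = v}) = Set.univ := by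
      ext ω
      simpa using A.position_mem G hN hs t ω n
    rw [this]
    simp
  · intro w _ w' _ hww'
    exact Set.disjoint_left.2 fun B h h' => hww' (h.symm.trans h')
  · exact fun w _ => A.measurableSet_position hN hs t n w

/-- The number of steps dominates the number of times `i < n` at which the target has not yet been
reached, because the target is absorbing. -/
lemma ofReal_sum_le_expectedSteps (hN : ∀ v ∈ G.verts, (G.nbrs v).Nonempty) {s : Plane}
    (hs : s ∈ G.verts) (t : Plane) (n : ℕ) :
    ENNReal.ofReal (∑ i ∈ Finset.range n, (1 - runLaw.real {ω | A.position G s t ω i = t})) ≤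
      A.expectedSteps G s t := by
  have hmeas := fun i => A.measurableSet_position hN hs t i t
  have h1 : ENNReal.ofReal
      (∑ i ∈ Finset.range n, (1 - runLaw.real {ω | A.position G s t ω i = t})) =
      ∫⁻ ω, ∑ i ∈ Finset.range n,
        ({ω | A.position G s t ω i = t}ᶜ).indicator (fun _ => (1 : ℝ≥0∞)) ω ∂runLaw := by
    rw [lintegral_finsetSum _ fun i _ => measurable_const.indicator (hmeas i).compl,
      ENNReal.ofReal_sum_of_nonneg fun i _ => sub_nonneg.2 measureReal_le_one]
    refine Finset.sum_congr rfl fun i _ => ?_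
    rw [lintegral_indicator (hmeas i).compl, ← probReal_compl_eq_one_sub (hmeas i)]
    simp
  rw [h1]
  refine lintegral_mono fun ω => ?_
  refine le_iInf₂ fun m hm => ?_
  calc ∑ i ∈ Finset.range n,
        ({ω | A.position G s t ω i = t}ᶜ).indicator (fun _ => (1 : ℝ≥0∞)) ω
      ≤ ∑ i ∈ Finset.range n, if i < m then (1 : ℝ≥0∞) else 0 := by
        refine Finset.sum_le_sum fun i _ => ?_
        by_cases him : i < m
        · rw [if_pos him]
          exact Set.indicator_le_self' (by simp) ω
        · rw [if_neg him, Set.indicator_of_notMem]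
          simpa using A.position_eq_target_of_le G (not_lt.1 him) hm
    _ = ((((Finset.range n).filter (· < m)).card : ℕ) : ℝ≥0∞) := by
        rw [Finset.sum_ite]
        simp
    _ ≤ m := by
        have : ((Finset.range n).filter (· < m)).card ≤ (Finset.range m).card :=
          Finset.card_le_card fun i hi => by simpa using (Finset.mem_filter.1 hi).2
        rw [Finset.card_range] at this
        exact_mod_cast this

/-- A nonnegative function `φ` that vanishes at the target and drops by at most one in expectation
in each step is a lower bound for the expected number of steps. -/
lemma ofReal_le_expectedSteps_of_potential (hN : ∀ v ∈ G.verts, (G.nbrs v).Nonempty) {t : Plane}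
    (ht : t ∈ G.verts) (φ : Plane → ℝ) (hφ : ∀ v ∈ G.verts, 0 ≤ φ v) (hφt : φ t = 0)
    (hdrop : ∀ v ∈ G.verts, v ≠ t →
      φ v ≤ 1 + ∑ w ∈ G.nbrs v, A.moveProb t v (G.nbrs v) w * φ w)
    {s : Plane} (hs : s ∈ G.verts) :
    ENNReal.ofReal (φ s) ≤ A.expectedSteps G s t := by
  set P : ℕ → Plane → ℝ := fun n v => runLaw.real {ω | A.position G s t ω n = v} with hP
  have hP0 : ∀ n v, 0 ≤ P n v := fun n v => measureReal_nonneg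
  set a : ℕ → ℝ := fun n => ∑ v ∈ G.verts, P n v * φ v with ha
  set u : ℕ → ℝ := fun n => 1 - P n t with hu
  have hu0 : ∀ n, 0 ≤ u n := fun n => sub_nonneg.2 measureReal_le_one
  have hPu : ∀ n, ∑ v ∈ G.verts.erase t, P n v = u n := by
    intro n
    have h := A.sum_runLaw_position hN hs t n
    rw [← Finset.sum_erase_add _ _ ht] at h
    exact eq_sub_of_add_eq h
  have ha_erase : ∀ n, a n = ∑ v ∈ G.verts.erase t, P n v * φ v := by
    intro n
    rw [ha]
    simp only
    rw [← Finset.sum_erase_add _ _ ht, hφt, mul_zero, add_zero]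
  have hdrop' : ∀ v ∈ G.verts.erase t,
      φ v - 1 ≤ ∑ w ∈ G.verts, A.moveProb t v (G.nbrs v) w * φ w := by
    intro v hv
    have h1 := hdrop v (Finset.mem_of_mem_erase hv) (Finset.ne_of_mem_erase hv)
    have h2 : ∑ w ∈ G.nbrs v, A.moveProb t v (G.nbrs v) w * φ w ≤
        ∑ w ∈ G.verts, A.moveProb t v (G.nbrs v) w * φ w :=
      Finset.sum_le_sum_of_subset_of_nonneg (G.nbrs_subset v) fun w hw _ =>
        mul_nonneg (A.moveProb_nonneg ..) (hφ w hw)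
    linarith
  have hstep : ∀ n, a n - u n ≤ a (n + 1) := by
    intro n
    have h1 : a (n + 1) = ∑ v ∈ G.verts,
        P n v * ∑ w ∈ G.verts, A.moveProb t v (G.nbrs v) w * φ w := by
      simp only [ha, hP, A.runLaw_position_succ hN hs, Finset.sum_mul, Finset.mul_sum]
      rw [Finset.sum_comm]
      simp only [mul_assoc]
    rw [h1, ha_erase, ← hPu, ← Finset.sum_sub_distrib, ← Finset.sum_erase_add _ _ ht]
    have h2 : 0 ≤ P n t * ∑ w ∈ G.verts, A.moveProb t t (G.nbrs t) w * φ w :=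
      mul_nonneg (hP0 _ _) (Finset.sum_nonneg fun w hw =>
        mul_nonneg (A.moveProb_nonneg ..) (hφ w hw))
    have h3 : ∑ v ∈ G.verts.erase t, (P n v * φ v - P n v) ≤ ∑ v ∈ G.verts.erase t,
        P n v * ∑ w ∈ G.verts, A.moveProb t v (G.nbrs v) w * φ w := by
      refine Finset.sum_le_sum fun v hv => ?_
      have := mul_le_mul_of_nonneg_left (hdrop' v hv) (hP0 n v)
      linarith
    linarith
  have hsum : ∀ n, φ s ≤ ∑ i ∈ Finset.range n, u i + a n := by
    intro n
    induction n with
    | zero =>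
      have : a 0 = φ s := by
        simp only [ha]
        rw [Finset.sum_eq_single s]
        · simp [hP, position]
        · intro v _ hv
          simp [hP, position, Ne.symm hv]
        · exact fun h => (h hs).elim
      simp [this]
    | succ n ih =>
      rw [Finset.sum_range_succ]
      linarith [hstep n]
  obtain ⟨b, hb⟩ : ∃ b, ∀ v ∈ G.verts, φ v ≤ b := by
    obtain ⟨b, hb⟩ := (G.verts.image φ).exists_le
    exact ⟨b, fun v hv => hb _ (Finset.mem_image_of_mem φ hv)⟩
  have hab : ∀ n, a n ≤ b * u n := by
    intro n
    rw [ha_erase, ← hPu, Finset.mul_sum]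
    refine Finset.sum_le_sum fun v hv => ?_
    rw [mul_comm b]
    exact mul_le_mul_of_nonneg_left (hb v (Finset.mem_of_mem_erase hv)) (hP0 n v)
  by_cases htop : A.expectedSteps G s t = ⊤
  · rw [htop]
    exact le_top
  have hbound : ∀ n, ∑ i ∈ Finset.range n, u i ≤ (A.expectedSteps G s t).toReal := fun n =>
    (ENNReal.ofReal_le_iff_le_toReal htop).1 (A.ofReal_sum_le_expectedSteps hN hs t n)
  have hlim : Filter.Tendsto u Filter.atTop (nhds 0) :=
    (summable_of_sum_range_le hu0 hbound).tendsto_atTop_zero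
  rw [ENNReal.ofReal_le_iff_le_toReal htop]
  have hlim' : Filter.Tendsto (fun n => (A.expectedSteps G s t).toReal + b * u n) Filter.atTop
      (nhds (A.expectedSteps G s t).toReal) := by
    simpa using (hlim.const_mul b).const_add (A.expectedSteps G s t).toReal
  exact ge_of_tendsto' hlim' fun n => by linarith [hsum n, hab n, hbound n]

end MemorylessAlgorithm

/-! ### Crossing a path in one of its two directions takes quadratic time -/

/-- For the nearest-neighbour walk on `{0, …, k}` that moves from `0 < j < k` up with probability
`f j` and down with probability `b j`, a potential certifying that, with a reflecting end `0`, it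
takes at least `k ^ 2` expected steps to get from `0` to `k`. -/
def IsSlow (k : ℕ) (f b : ℕ → ℝ) : Prop :=
  ∃ φ : ℕ → ℝ, φ 0 = (k : ℝ) ^ 2 ∧ φ k = 0 ∧ (∀ j, 0 ≤ φ j) ∧ (k : ℝ) ^ 2 - 1 ≤ φ 1 ∧
    ∀ j, 0 < j → j < k → φ j ≤ 1 + f j * φ (j + 1) + b j * φ (j - 1)

/-- A potential is built from its decrements `D j` along the edges, which may be scaled down. -/
lemma IsSlow.of_drops {k : ℕ} (hk : 0 < k) {f b : ℕ → ℝ}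
    (hfb : ∀ j, 0 < j → j < k → f j + b j = 1) (D : ℕ → ℝ) (hD : ∀ j < k, 0 ≤ D j) (hD0 : D 0 ≤ 1)
    (hsum : (k : ℝ) ^ 2 ≤ ∑ i ∈ Finset.range k, D i)
    (hstep : ∀ j, j + 1 < k → f (j + 1) * D (j + 1) ≤ 1 + b (j + 1) * D j) :
    IsSlow k f b := by
  set S := ∑ i ∈ Finset.range k, D i with hS
  have hk2 : (0 : ℝ) < (k : ℝ) ^ 2 := by positivity
  have hSpos : 0 < S := hk2.trans_le hsum
  set c := (k : ℝ) ^ 2 / S with hc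
  have hc0 : 0 ≤ c := by positivity
  have hc1 : c ≤ 1 := (div_le_one hSpos).2 hsum
  have hcS : c * S = (k : ℝ) ^ 2 := div_mul_cancel₀ _ hSpos.ne'
  have hrec : ∀ j < k, ∑ i ∈ Finset.Ico j k, D i = D j + ∑ i ∈ Finset.Ico (j + 1) k, D i :=
    fun j hj => Finset.sum_eq_sum_Ico_succ_bot hj D
  have h0 : ∑ i ∈ Finset.Ico 0 k, D i = S := by rw [hS, Finset.range_eq_Ico]
  refine ⟨fun j => c * ∑ i ∈ Finset.Ico j k, D i, ?_, ?_, ?_, ?_, ?_⟩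
  · simp only [h0, hcS]
  · simp
  · exact fun j => mul_nonneg hc0 (Finset.sum_nonneg fun i hi => hD i (Finset.mem_Ico.1 hi).2)
  · have h1 := hrec 0 hk
    rw [h0] at h1
    have h2 : ∑ i ∈ Finset.Ico 1 k, D i = S - D 0 := by rw [h1]; simp
    simp only [h2, mul_sub, hcS]
    nlinarith [hD 0 hk]
  · intro j hj0 hjk
    obtain ⟨j, rfl⟩ := Nat.exists_eq_succ_of_ne_zero hj0.ne'
    simp only [Nat.succ_eq_add_one, Nat.add_sub_cancel] at *
    rw [hrec j (by omega), hrec (j + 1) hjk]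
    have h1 := mul_le_mul_of_nonneg_left (hstep j hjk) hc0
    have h2 := hfb (j + 1) hj0 hjk
    set X := ∑ i ∈ Finset.Ico (j + 1 + 1) k, D i
    have h3 : c * (D (j + 1) + X) = f (j + 1) * (c * (D (j + 1) + X)) +
        b (j + 1) * (c * (D (j + 1) + X)) := by rw [← add_mul, h2, one_mul]
    linarith

lemma IsSlow.of_eq_zero {k : ℕ} (hk : 0 < k) {f b : ℕ → ℝ}
    (hfb : ∀ j, 0 < j → j < k → f j + b j = 1) (hb : ∀ j, 0 < j → j < k → 0 ≤ b j)
    {j : ℕ} (hj : j + 1 < k) (hfj : f (j + 1) = 0) : IsSlow k f b := by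
  refine IsSlow.of_drops hk hfb (fun i => if i = j + 1 then (k : ℝ) ^ 2 else 0) ?_ ?_ ?_ ?_
  · intro i _
    split_ifs <;> positivity
  · simp
  · rw [Finset.sum_ite_eq' (Finset.range k), if_pos (Finset.mem_range.2 hj)]
  · intro i hi
    have hbi := hb (i + 1) i.succ_pos hi
    by_cases h : i = j
    · subst h
      simp [hfj]
    · have : 0 ≤ (if i = j + 1 then (k : ℝ) ^ 2 else 0) := by split_ifs <;> positivity
      simp only [Nat.add_right_cancel_iff, h, if_false, mul_zero]
      positivity

/-- The commute time bound. With resistances `r` and conductances `r⁻¹` describing the walk, the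
expected times needed to cross the edge `j` upwards and downwards sum up to `2 r j ∑ i, (r i)⁻¹`,
and the sum of these over all edges is at least `2 k ^ 2` by the Cauchy-Schwarz inequality. -/
theorem isSlow_or_isSlow_reverse {k : ℕ} (hk : 0 < k) {f b : ℕ → ℝ}
    (hf : ∀ j, 0 < j → j < k → 0 ≤ f j) (hb : ∀ j, 0 < j → j < k → 0 ≤ b j)
    (hfb : ∀ j, 0 < j → j < k → f j + b j = 1) :
    IsSlow k f b ∨ IsSlow k (fun j => b (k - j)) (fun j => f (k - j)) := by
  have hbf' : ∀ j, 0 < j → j < k → b (k - j) + f (k - j) = 1 := fun j h0 h1 => by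
    rw [add_comm]
    exact hfb _ (by omega) (by omega)
  by_cases hf0 : ∃ j, j + 1 < k ∧ f (j + 1) = 0
  · obtain ⟨j, hj, hfj⟩ := hf0
    exact Or.inl (IsSlow.of_eq_zero hk hfb hb hj hfj)
  by_cases hb0 : ∃ j, j + 1 < k ∧ b (j + 1) = 0
  · obtain ⟨j, hj, hbj⟩ := hb0
    refine Or.inr (IsSlow.of_eq_zero hk hbf' (fun i _ _ => hf _ (by omega) (by omega))
      (j := k - (j + 2)) (by omega) ?_)
    rwa [show k - (k - (j + 2) + 1) = j + 1 by omega]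
  push Not at hf0 hb0
  have hfpos : ∀ j, j + 1 < k → 0 < f (j + 1) := fun j hj =>
    (hf _ j.succ_pos hj).lt_of_ne' (hf0 j hj)
  have hbpos : ∀ j, j + 1 < k → 0 < b (j + 1) := fun j hj =>
    (hb _ j.succ_pos hj).lt_of_ne' (hb0 j hj)
  let r : ℕ → ℝ := fun n => Nat.rec 1 (fun j x => x * b (j + 1) / f (j + 1)) n
  have hr_succ : ∀ j, r (j + 1) = r j * b (j + 1) / f (j + 1) := fun j => rfl
  have hr : ∀ j < k, 0 < r j := by
    intro j
    induction j with
    | zero => exact fun _ => one_pos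
    | succ j ih =>
      intro hj
      rw [hr_succ]
      have := ih (by omega)
      have := hfpos j hj
      have := hbpos j hj
      positivity
  let C : ℕ → ℝ := fun j => ∑ i ∈ Finset.range j, (r i)⁻¹
  have hC_succ : ∀ j, C (j + 1) = C j + (r j)⁻¹ := fun j => Finset.sum_range_succ _ j
  have hC_nonneg : ∀ j ≤ k, 0 ≤ C j := fun j hj =>
    Finset.sum_nonneg fun i hi => (inv_pos.2 (hr i (by have := Finset.mem_range.1 hi; omega))).le
  have hC_mono : ∀ j ≤ k, C j ≤ C k := fun j hj =>
    Finset.sum_le_sum_of_subset_of_nonneg (Finset.range_mono hj) fun i hi _ =>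
      (inv_pos.2 (hr i (Finset.mem_range.1 hi))).le
  let D : ℕ → ℝ := fun j => r j * (2 * C j + (r j)⁻¹)
  let E : ℕ → ℝ := fun j => r j * (2 * (C k - C j) - (r j)⁻¹)
  have hD : ∀ j < k, 0 ≤ D j := fun j hj => by
    have := hr j hj
    have := hC_nonneg j hj.le
    positivity
  have hE : ∀ j < k, 0 ≤ E j := fun j hj => by
    have h1 := hr j hj
    have h2 := hC_mono (j + 1) hj
    have h3 : 0 < (r j)⁻¹ := inv_pos.2 h1
    rw [hC_succ] at h2
    exact mul_nonneg h1.le (by linarith)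
  have hDstep : ∀ j, j + 1 < k → f (j + 1) * D (j + 1) = 1 + b (j + 1) * D j := by
    intro j hj
    have h1 := (hr j (by omega)).ne'
    have h2 := (hfpos j hj).ne'
    have h3 := (hbpos j hj).ne'
    have h4 := hfb (j + 1) j.succ_pos hj
    simp only [D, hC_succ, hr_succ]
    field_simp
    linear_combination h4
  have hEstep : ∀ j, j + 1 < k → b (j + 1) * E j = 1 + f (j + 1) * E (j + 1) := by
    intro j hj
    have h1 := (hr j (by omega)).ne'
    have h2 := (hfpos j hj).ne'
    have h3 := (hbpos j hj).ne'
    have h4 := hfb (j + 1) j.succ_pos hj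
    simp only [E, hC_succ, hr_succ]
    field_simp
    linear_combination h4
  have hsum : 2 * (k : ℝ) ^ 2 ≤ ∑ j ∈ Finset.range k, D j + ∑ j ∈ Finset.range k, E j := by
    have h1 : ∀ j, D j + E j = 2 * (r j * C k) := fun j => by simp only [D, E]; ring
    rw [← Finset.sum_add_distrib]
    simp only [h1, ← Finset.mul_sum, ← Finset.sum_mul]
    have h2 := Finset.sum_sq_le_sum_mul_sum_of_sq_le_mul (Finset.range k) (r := fun _ => (1 : ℝ))
      (f := r) (g := fun i => (r i)⁻¹) (fun i hi => (hr i (Finset.mem_range.1 hi)).le)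
      (fun i hi => (inv_pos.2 (hr i (Finset.mem_range.1 hi))).le)
      (fun i hi => by
        rw [one_pow, mul_inv_cancel₀ (hr i (Finset.mem_range.1 hi)).ne'])
    simp only [Finset.sum_const, Finset.card_range, nsmul_eq_mul, mul_one] at h2
    linarith
  rcases le_total ((k : ℝ) ^ 2) (∑ j ∈ Finset.range k, D j) with h | h
  · refine Or.inl (IsSlow.of_drops hk hfb D hD ?_ h fun j hj => (hDstep j hj).le)
    simp [D, C, r]
  · refine Or.inr (IsSlow.of_drops hk hbf' (fun j => E (k - 1 - j)) (fun j hj => hE _ (by omega))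
      ?_ ?_ fun j hj => ?_)
    · obtain ⟨k, rfl⟩ := Nat.exists_eq_succ_of_ne_zero hk.ne'
      have := (hr k (by omega)).ne'
      simp only [E, Nat.succ_eq_add_one, hC_succ, Nat.add_sub_cancel, Nat.sub_zero]
      field_simp
      linarith
    · rw [Finset.sum_range_reflect]
      linarith
    · have h1 := hEstep (k - 1 - (j + 1)) (by omega)
      rw [show k - 1 - (j + 1) + 1 = k - (j + 1) by omega] at h1
      rw [show k - 1 - j = k - (j + 1) by omega, h1]

/-! ### Graphs obtained by subdividing the sides of a drawing -/

/-- A drawing made of straight sides, the `i`-th one going from `src i` to `tgt i`. -/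
structure Frame (ι : Type) where
  src : ι → Plane
  tgt : ι → Plane

namespace Frame

variable {ι : Type} (F : Frame ι)

/-- The points covered by the sides. -/
def carrier : Set Plane := ⋃ i, segment ℝ (F.src i) (F.tgt i)

/-- The sides of the drawing are nondegenerate, two of them meet at common endpoints only, and the
drawing is connected; the latter is phrased as an induction principle. -/
structure Proper : Prop where
  ne : ∀ i, F.src i ≠ F.tgt i
  inter : ∀ i j, i ≠ j → ∀ x ∈ segment ℝ (F.src i) (F.tgt i), x ∈ segment ℝ (F.src j) (F.tgt j) →
    x = F.src i ∨ x = F.tgt i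
  conn : ∀ (i₀ : ι) (X : Set Plane), F.src i₀ ∈ X → (∀ i, F.src i ∈ X ↔ F.tgt i ∈ X) →
    ∀ i, F.src i ∈ X

variable (n : ι → ℕ)

/-- The `j`-th of the points that divide the `i`-th side into `n i` equal parts. -/
noncomputable def node (i : ι) (j : ℕ) : Plane :=
  AffineMap.lineMap (F.src i) (F.tgt i) ((j : ℝ) / n i)

/-- Consecutive points on one of the subdivided sides. -/
def Link (u v : Plane) : Prop := ∃ i, ∃ j < n i, u = F.node n i j ∧ v = F.node n i (j + 1)

variable {F n}

lemma node_zero (i : ι) : F.node n i 0 = F.src i := by simp [node]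

lemma node_last {i : ι} (hn : 0 < n i) : F.node n i (n i) = F.tgt i := by
  have : (n i : ℝ) ≠ 0 := by positivity
  simp [node, div_self this]

lemma Proper.node_injective (h : F.Proper) {i : ι} (hn : 0 < n i) :
    Function.Injective (F.node n i) := by
  intro j j' hjj'
  have h1 := AffineMap.lineMap_injective ℝ (h.ne i) hjj'
  have : (n i : ℝ) ≠ 0 := by positivity
  exact_mod_cast (div_left_inj' this).1 h1

lemma node_mem_segment {i : ι} {j : ℕ} (hj : j ≤ n i) :
    F.node n i j ∈ segment ℝ (F.src i) (F.tgt i) := by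
  rw [segment_eq_image_lineMap]
  refine ⟨_, ⟨by positivity, div_le_one_of_le₀ (by exact_mod_cast hj) (by positivity)⟩, rfl⟩

/-- An edge consists of the points whose parameter, in units of the edge length, lies between two
consecutive integers. -/
lemma mem_segment_node {i : ι} (hn : 0 < n i) (j : ℕ) (x : Plane) :
    x ∈ segment ℝ (F.node n i j) (F.node n i (j + 1)) ↔
      ∃ a : ℝ, (j : ℝ) ≤ a ∧ a ≤ j + 1 ∧ AffineMap.lineMap (F.src i) (F.tgt i) (a / n i) = x := by
  have hn' : (0 : ℝ) < n i := by exact_mod_cast hn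
  have hle : ((j : ℝ) / n i) ≤ ((j + 1 : ℕ) : ℝ) / n i := by
    gcongr
    simp
  rw [node, node, ← image_segment, segment_eq_Icc hle]
  constructor
  · rintro ⟨b, ⟨h1, h2⟩, rfl⟩
    refine ⟨b * n i, (div_le_iff₀ hn').1 h1, ?_, by rw [mul_div_cancel_right₀ _ hn'.ne']⟩
    have := (le_div_iff₀ hn').1 h2
    push_cast at this
    exact this
  · rintro ⟨a, h1, h2, rfl⟩
    refine ⟨a / n i, ⟨by gcongr, ?_⟩, rfl⟩
    push_cast
    gcongr

lemma segment_node_subset {i : ι} {j : ℕ} (hj : j < n i) :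
    segment ℝ (F.node n i j) (F.node n i (j + 1)) ⊆ segment ℝ (F.src i) (F.tgt i) :=
  (convex_segment _ _).segment_subset (node_mem_segment hj.le) (node_mem_segment hj)

lemma Proper.eq_or_eq_of_node_mem (h : F.Proper) {i : ι} {j j' : ℕ} (hn : 0 < n i)
    (hmem : F.node n i j' ∈ segment ℝ (F.node n i j) (F.node n i (j + 1))) :
    j' = j ∨ j' = j + 1 := by
  obtain ⟨a, h1, h2, h3⟩ := (mem_segment_node hn j _).1 hmem
  have hn' : (n i : ℝ) ≠ 0 := by positivity
  have h4 := (div_left_inj' hn').1 (AffineMap.lineMap_injective ℝ (h.ne i) h3)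
  rw [h4] at h1 h2
  have h5 : j ≤ j' := by exact_mod_cast h1
  have h6 : j' ≤ j + 1 := by exact_mod_cast h2
  omega

lemma Proper.eq_or_eq_of_mem_edge (h : F.Proper) (hn : ∀ i, 0 < n i) {i i' : ι} (hii' : i ≠ i')
    {j : ℕ} (hj : j < n i) {x : Plane}
    (hx : x ∈ segment ℝ (F.node n i j) (F.node n i (j + 1)))
    (hx' : x ∈ segment ℝ (F.src i') (F.tgt i')) :
    x = F.node n i j ∨ x = F.node n i (j + 1) := by
  obtain ⟨j', rfl⟩ : ∃ j', x = F.node n i j' := by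
    rcases h.inter i i' hii' x (segment_node_subset hj hx) hx' with rfl | rfl
    · exact ⟨0, (node_zero i).symm⟩
    · exact ⟨n i, (node_last (hn i)).symm⟩
  rcases h.eq_or_eq_of_node_mem (hn i) hx with rfl | rfl
  · exact Or.inl rfl
  · exact Or.inr rfl

lemma Proper.eq_zero_or_eq_last (h : F.Proper) (hn : ∀ i, 0 < n i) {i i' : ι} (hii' : i ≠ i')
    {j j' : ℕ} (hj : j ≤ n i) (hj' : j' ≤ n i') (heq : F.node n i j = F.node n i' j') :
    j = 0 ∨ j = n i := by
  rcases h.inter i i' hii' _ (node_mem_segment hj) (heq ▸ node_mem_segment hj') with h1 | h1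
  · rw [← node_zero (n := n)] at h1
    exact Or.inl (h.node_injective (hn i) h1)
  · rw [← node_last (hn i)] at h1
    exact Or.inr (h.node_injective (hn i) h1)

lemma segment_eq_of_sym2_eq {u v x y : Plane} (h : s(u, v) = s(x, y)) :
    segment ℝ u v = segment ℝ x y ∧ ({u, v} : Set Plane) = {x, y} := by
  rcases Sym2.eq_iff.1 h with ⟨rfl, rfl⟩ | ⟨rfl, rfl⟩
  · exact ⟨rfl, rfl⟩
  · exact ⟨segment_symm ℝ _ _, Set.pair_comm _ _⟩

lemma Proper.inter_edges_subset (h : F.Proper) (hn : ∀ i, 0 < n i) {i i' : ι} {j j' : ℕ}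
    (hj : j < n i) (hj' : j' < n i')
    (hne : s(F.node n i j, F.node n i (j + 1)) ≠ s(F.node n i' j', F.node n i' (j' + 1)))
    {x : Plane} (hx : x ∈ segment ℝ (F.node n i j) (F.node n i (j + 1)))
    (hx' : x ∈ segment ℝ (F.node n i' j') (F.node n i' (j' + 1))) :
    x = F.node n i j ∨ x = F.node n i (j + 1) := by
  by_cases hii' : i = i'
  · subst hii'
    obtain ⟨a, h1, h2, rfl⟩ := (mem_segment_node (hn i) j x).1 hx
    obtain ⟨b, h3, h4, h5⟩ := (mem_segment_node (hn i) j' _).1 hx'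
    have hn' : (n i : ℝ) ≠ 0 := by have := hn i; positivity
    have hba := (div_left_inj' hn').1 (AffineMap.lineMap_injective ℝ (h.ne i) h5)
    subst hba
    rcases lt_trichotomy j j' with hlt | rfl | hlt
    · right
      have : (j : ℝ) + 1 ≤ j' := by exact_mod_cast hlt
      have : b = ((j + 1 : ℕ) : ℝ) := by push_cast; linarith
      rw [this]
      rfl
    · exact (hne rfl).elim
    · left
      have : (j' : ℝ) + 1 ≤ j := by exact_mod_cast hlt
      have : b = (j : ℝ) := by linarith
      rw [this]
      rfl
  · exact h.eq_or_eq_of_mem_edge hn hii' hj hx (segment_node_subset hj' hx')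

variable [Fintype ι]

open Classical in
/-- The geometric graph obtained by dividing the `i`-th side of `F` into `n i` edges. -/
noncomputable def toGraph (F : Frame ι) (n : ι → ℕ) : GeometricGraph where
  verts := Finset.univ.biUnion fun i => (Finset.range (n i + 1)).image (F.node n i)
  graph := SimpleGraph.fromRel (F.Link n)
  adj_mem := by
    intro u v h
    simp only [Finset.mem_biUnion, Finset.mem_univ, true_and, Finset.mem_image, Finset.mem_range]
    rcases h.2 with ⟨i, j, hj, rfl, rfl⟩ | ⟨i, j, hj, rfl, rfl⟩
    · exact ⟨⟨i, j, by omega, rfl⟩, ⟨i, j + 1, by omega, rfl⟩⟩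
    · exact ⟨⟨i, j + 1, by omega, rfl⟩, ⟨i, j, by omega, rfl⟩⟩

lemma mem_verts {v : Plane} : v ∈ (F.toGraph n).verts ↔ ∃ i, ∃ j ≤ n i, F.node n i j = v := by
  simp [toGraph]

lemma node_mem_verts {i : ι} {j : ℕ} (hj : j ≤ n i) : F.node n i j ∈ (F.toGraph n).verts :=
  mem_verts.2 ⟨i, j, hj, rfl⟩

lemma adj_iff {u v : Plane} :
    (F.toGraph n).graph.Adj u v ↔ u ≠ v ∧ (F.Link n u v ∨ F.Link n v u) :=
  SimpleGraph.fromRel_adj _ _ _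

lemma Proper.adj_node_succ (h : F.Proper) {i : ι} {j : ℕ} (hj : j < n i) :
    (F.toGraph n).graph.Adj (F.node n i j) (F.node n i (j + 1)) :=
  adj_iff.2 ⟨fun he => by have := h.node_injective (by omega) he; omega,
    Or.inl ⟨i, j, hj, rfl, rfl⟩⟩

/-- Every edge is one of the parts of a side, up to orientation. -/
lemma exists_of_adj {u v : Plane} (huv : (F.toGraph n).graph.Adj u v) :
    ∃ i, ∃ j < n i, s(u, v) = s(F.node n i j, F.node n i (j + 1)) := by
  rcases (adj_iff.1 huv).2 with ⟨i, j, hj, rfl, rfl⟩ | ⟨i, j, hj, rfl, rfl⟩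
  · exact ⟨i, j, hj, rfl⟩
  · exact ⟨i, j, hj, Sym2.eq_swap⟩

lemma Proper.isPlane (h : F.Proper) (hn : ∀ i, 0 < n i) : (F.toGraph n).IsPlane := by
  constructor
  · intro u v w huv hw hmem
    obtain ⟨i, j, hj, he⟩ := exists_of_adj huv
    obtain ⟨i', j', hj', rfl⟩ := mem_verts.1 hw
    obtain ⟨h1, h2⟩ := segment_eq_of_sym2_eq he
    rw [h1] at hmem
    suffices F.node n i' j' ∈ ({u, v} : Set Plane) by simpa using this
    rw [h2, Set.mem_insert_iff, Set.mem_singleton_iff]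
    by_cases hii' : i = i'
    · subst hii'
      rcases h.eq_or_eq_of_node_mem (hn i) hmem with rfl | rfl <;> simp
    · exact h.eq_or_eq_of_mem_edge hn hii' hj hmem (node_mem_segment hj')
  · intro u v x y huv hxy hne z hz
    obtain ⟨i, j, hj, he⟩ := exists_of_adj huv
    obtain ⟨i', j', hj', he'⟩ := exists_of_adj hxy
    obtain ⟨h1, h2⟩ := segment_eq_of_sym2_eq he
    obtain ⟨h1', h2'⟩ := segment_eq_of_sym2_eq he'
    rw [h1, h1'] at hz
    rw [he, he'] at hne
    rw [h2, h2']
    exact ⟨h.inter_edges_subset hn hj hj' hne hz.1 hz.2,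
      h.inter_edges_subset hn hj' hj hne.symm hz.2 hz.1⟩

lemma Proper.reachable_node (h : F.Proper) (i : ι) {j : ℕ} (hj : j ≤ n i) :
    (F.toGraph n).graph.Reachable (F.src i) (F.node n i j) := by
  induction j with
  | zero => rw [node_zero]
  | succ j ih => exact (ih (by omega)).trans (h.adj_node_succ (by omega)).reachable

lemma Proper.reachable (h : F.Proper) (hn : ∀ i, 0 < n i) :
    ∀ u ∈ (F.toGraph n).verts, ∀ v ∈ (F.toGraph n).verts, (F.toGraph n).graph.Reachable u v := by
  intro u hu v hv
  obtain ⟨i, j, hj, rfl⟩ := mem_verts.1 hu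
  obtain ⟨i', j', hj', rfl⟩ := mem_verts.1 hv
  have hsides : ∀ i, (F.toGraph n).graph.Reachable (F.src i) (F.tgt i) := fun i => by
    simpa only [node_last (hn i)] using h.reachable_node i (n := n) le_rfl
  have key := h.conn i {x | (F.toGraph n).graph.Reachable (F.src i) x}
    (SimpleGraph.Reachable.refl _)
    (fun l => ⟨fun hl => hl.trans (hsides l), fun hl => hl.trans (hsides l).symm⟩) i'
  exact (h.reachable_node i hj).symm.trans (key.trans (h.reachable_node i' hj'))

lemma Proper.drawing_toGraph (h : F.Proper) (hn : ∀ i, 0 < n i) :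
    (F.toGraph n).drawing = F.carrier := by
  apply Set.Subset.antisymm
  · rintro x (hx | ⟨u, v, huv, hx⟩)
    · obtain ⟨i, j, hj, rfl⟩ := mem_verts.1 hx
      exact Set.mem_iUnion.2 ⟨i, node_mem_segment hj⟩
    · obtain ⟨i, j, hj, he⟩ := exists_of_adj huv
      rw [(segment_eq_of_sym2_eq he).1] at hx
      exact Set.mem_iUnion.2 ⟨i, segment_node_subset hj hx⟩
  · intro x hx
    obtain ⟨i, hi⟩ := Set.mem_iUnion.1 hx
    rw [segment_eq_image_lineMap] at hi
    obtain ⟨a, ⟨ha0, ha1⟩, rfl⟩ := hi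
    have hn' : (0 : ℝ) < n i := by exact_mod_cast hn i
    have hmem : ∃ j < n i, (j : ℝ) ≤ a * n i ∧ a * n i ≤ j + 1 := by
      rcases ha1.lt_or_eq with hlt | rfl
      · refine ⟨⌊a * n i⌋₊, ?_, Nat.floor_le (by positivity), (Nat.lt_floor_add_one _).le⟩
        rw [Nat.floor_lt (by positivity)]
        nlinarith
      · obtain ⟨m, hm⟩ := Nat.exists_eq_succ_of_ne_zero (hn i).ne'
        refine ⟨m, by omega, ?_, ?_⟩ <;> rw [hm] <;> push_cast <;> linarith
    obtain ⟨j, hj, h1, h2⟩ := hmem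
    refine Or.inr ⟨_, _, h.adj_node_succ hj, (mem_segment_node (hn i) j _).2
      ⟨a * n i, h1, h2, ?_⟩⟩
    rw [mul_div_cancel_right₀ _ hn'.ne']

lemma mem_nbrs {G : GeometricGraph} {v w : Plane} : w ∈ G.nbrs v ↔ G.graph.Adj v w := by
  classical
  unfold GeometricGraph.nbrs
  rw [Finset.mem_filter]
  exact ⟨fun h => h.2, fun h => ⟨(G.adj_mem v w h).2, h⟩⟩

lemma Proper.nbrs_nonempty (h : F.Proper) (hn : ∀ i, 0 < n i) :
    ∀ v ∈ (F.toGraph n).verts, ((F.toGraph n).nbrs v).Nonempty := by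
  intro v hv
  obtain ⟨i, j, hj, rfl⟩ := mem_verts.1 hv
  have := hn i
  rcases hj.lt_or_eq with hlt | rfl
  · exact ⟨_, mem_nbrs.2 (h.adj_node_succ hlt)⟩
  · obtain ⟨m, hm⟩ := Nat.exists_eq_succ_of_ne_zero this.ne'
    refine ⟨F.node n i m, mem_nbrs.2 ?_⟩
    have := h.adj_node_succ (n := n) (i := i) (j := m) (by omega)
    rw [hm]
    exact this.symm

/-- A vertex in the interior of a side sees only its two neighbours on that side, whatever the rest
of the drawing is. -/
lemma Proper.nbrs_node [DecidableEq Plane] (h : F.Proper) (hn : ∀ i, 0 < n i) {i : ι} {j : ℕ}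
    (hj0 : 0 < j) (hj : j < n i) :
    (F.toGraph n).nbrs (F.node n i j) = {F.node n i (j + 1), F.node n i (j - 1)} := by
  ext w
  rw [mem_nbrs, Finset.mem_insert, Finset.mem_singleton]
  obtain ⟨j, rfl⟩ := Nat.exists_eq_succ_of_ne_zero hj0.ne'
  simp only [Nat.succ_eq_add_one, Nat.add_sub_cancel] at *
  constructor
  · intro hw
    rcases (adj_iff.1 hw).2 with ⟨i', j', hj', he, rfl⟩ | ⟨i', j', hj', rfl, he⟩
    · by_cases hii' : i = i'
      · subst hii'
        rw [h.node_injective (hn i) he]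
        exact Or.inl rfl
      · have := h.eq_zero_or_eq_last hn hii' hj.le hj'.le he
        omega
    · by_cases hii' : i = i'
      · subst hii'
        have := h.node_injective (hn i) he
        rw [show j' = j by omega]
        exact Or.inr rfl
      · have := h.eq_zero_or_eq_last hn hii' hj.le hj' he
        omega
  · rintro (rfl | rfl)
    · exact h.adj_node_succ hj
    · exact (h.adj_node_succ (by omega)).symm

lemma Proper.lt_card_verts (h : F.Proper) {i : ι} (hn : 0 < n i) :
    n i < (F.toGraph n).verts.card := by
  classical
  calc n i < ((Finset.range (n i + 1)).image (F.node n i)).card := by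
        rw [Finset.card_image_of_injective _ (h.node_injective hn), Finset.card_range]
        omega
    _ ≤ _ := Finset.card_le_card fun v hv => by
        obtain ⟨j, hj, rfl⟩ := Finset.mem_image.1 hv
        exact node_mem_verts (by have := Finset.mem_range.1 hj; omega)

lemma card_verts_le {k : ℕ} (hk : ∀ i, n i ≤ k) :
    (F.toGraph n).verts.card ≤ Fintype.card ι * (k + 1) := by
  classical
  refine Finset.card_biUnion_le_card_mul _ _ _ fun i _ => Finset.card_image_le.trans ?_
  rw [Finset.card_range]
  have := hk i
  omega

end Frame

/-! ### Slow arms and the expected time on a subdivided drawing -/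

lemma IsSlow.congr {k : ℕ} {f b f' b' : ℕ → ℝ} (h : IsSlow k f b)
    (hf : ∀ j, 0 < j → j < k → f j = f' j) (hb : ∀ j, 0 < j → j < k → b j = b' j) :
    IsSlow k f' b' := by
  obtain ⟨φ, h0, h1, h2, h3, h4⟩ := h
  refine ⟨φ, h0, h1, h2, h3, fun j hj0 hj => ?_⟩
  rw [← hf j hj0 hj, ← hb j hj0 hj]
  exact h4 j hj0 hj

/-- The `j`-th of the points that divide the segment from `p` to `q` into `k` equal parts. -/
noncomputable def armPoint (k : ℕ) (p q : Plane) (j : ℕ) : Plane :=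
  AffineMap.lineMap p q ((j : ℝ) / k)

lemma armPoint_injective {k : ℕ} (hk : 0 < k) {p q : Plane} (hpq : p ≠ q) :
    Function.Injective (armPoint k p q) := by
  intro j j' hjj'
  have h1 := AffineMap.lineMap_injective ℝ hpq hjj'
  have : (k : ℝ) ≠ 0 := by positivity
  exact_mod_cast (div_left_inj' this).1 h1

lemma armPoint_reverse {k : ℕ} (hk : 0 < k) (p q : Plane) {j : ℕ} (hj : j ≤ k) :
    armPoint k p q (k - j) = armPoint k q p j := by
  have : (k : ℝ) ≠ 0 := by positivity
  rw [armPoint, armPoint, Nat.cast_sub hj, sub_div, div_self this,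
    AffineMap.lineMap_apply_one_sub]

namespace MemorylessAlgorithm

variable (A : MemorylessAlgorithm)

open Classical in
/-- The path that divides the segment from `p` to `q` into `k` edges is slow if crossing it from
`p` to `q`, with a reflecting end `p`, takes at least `k ^ 2` expected steps. The direction matters:
`SlowArm t k q p` concerns the opposite crossing of the same path. -/
def SlowArm (t : Plane) (k : ℕ) (p q : Plane) : Prop :=
  IsSlow k
    (fun j => A.moveProb t (armPoint k p q j)
      {armPoint k p q (j + 1), armPoint k p q (j - 1)} (armPoint k p q (j + 1)))
    (fun j => A.moveProb t (armPoint k p q j)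
      {armPoint k p q (j + 1), armPoint k p q (j - 1)} (armPoint k p q (j - 1)))

theorem slowArm_or_slowArm_symm {t p q : Plane} {k : ℕ} (hk : 0 < k) (hpq : p ≠ q)
    (ht : t ∉ segment ℝ p q) : A.SlowArm t k p q ∨ A.SlowArm t k q p := by
  classical
  have hinj := armPoint_injective hk hpq
  refine (isSlow_or_isSlow_reverse hk (fun j _ _ => A.moveProb_nonneg _ _ _ _)
    (fun j _ _ => A.moveProb_nonneg _ _ _ _) ?_).imp_right fun h => h.congr ?_ ?_
  · intro j hj0 hj
    have hne : armPoint k p q j ≠ t := by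
      rintro rfl
      refine ht ?_
      rw [segment_eq_image_lineMap]
      exact ⟨_, ⟨by positivity, div_le_one_of_le₀ (by exact_mod_cast hj.le) (by positivity)⟩, rfl⟩
    have h1 := A.sum_moveProb (N := {armPoint k p q (j + 1), armPoint k p q (j - 1)})
      (Finset.insert_nonempty _ _) hne
    rwa [Finset.sum_pair (fun h => by have := hinj h; omega)] at h1
  all_goals
    intro j hj0 hj
    have h1 := armPoint_reverse hk p q hj.le
    have h2 : armPoint k p q (k - j + 1) = armPoint k q p (j - 1) := by
      rw [← armPoint_reverse hk p q (j := j - 1) (by omega)]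
      congr 1
      omega
    have h3 : armPoint k p q (k - j - 1) = armPoint k q p (j + 1) := by
      rw [← armPoint_reverse hk p q (j := j + 1) (by omega)]
      congr 1
    simp only [h1, h2, h3]
    rw [Finset.pair_comm]

end MemorylessAlgorithm

namespace Frame

variable {ι : Type} {F : Frame ι} {n : ι → ℕ}

/-- Functions on the subdivided sides that agree at the corners glue to a function on the plane. -/
lemma Proper.exists_glue (h : F.Proper) (hn : ∀ i, 0 < n i) (ψ : Plane → ℝ) (φ : ι → ℕ → ℝ)
    (h0 : ∀ i, φ i 0 = ψ (F.src i)) (h1 : ∀ i, φ i (n i) = ψ (F.tgt i)) :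
    ∃ Φ : Plane → ℝ, ∀ i, ∀ j ≤ n i, Φ (F.node n i j) = φ i j := by
  have hwd : ∀ i i' j j', j ≤ n i → j' ≤ n i' → F.node n i j = F.node n i' j' →
      φ i j = φ i' j' := by
    intro i i' j j' hj hj' he
    by_cases hii' : i = i'
    · subst hii'
      rw [h.node_injective (hn i) he]
    · have hcorner : ∀ i j, j = 0 ∨ j = n i → φ i j = ψ (F.node n i j) := by
        rintro i j (rfl | rfl)
        · rw [h0, node_zero]
        · rw [h1, node_last (hn i)]
      rw [hcorner i j (h.eq_zero_or_eq_last hn hii' hj hj' he),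
        hcorner i' j' (h.eq_zero_or_eq_last hn (Ne.symm hii') hj' hj he.symm), he]
  classical
  refine ⟨fun v => if hv : ∃ ij : ι × ℕ, ij.2 ≤ n ij.1 ∧ F.node n ij.1 ij.2 = v then
    φ hv.choose.1 hv.choose.2 else 0, fun i j hj => ?_⟩
  have hv : ∃ ij : ι × ℕ, ij.2 ≤ n ij.1 ∧ F.node n ij.1 ij.2 = F.node n i j := ⟨(i, j), hj, rfl⟩
  exact (dif_pos hv).trans (hwd _ _ _ _ hv.choose_spec.1 hj hv.choose_spec.2)

/-- If every side that leads out of the set `S` of corners is a slow arm, then getting from `S` to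
a target outside `S` takes at least `k ^ 2` expected steps. -/
theorem Proper.ofReal_sq_le_expectedSteps [Fintype ι] (h : F.Proper) (A : MemorylessAlgorithm)
    {t : Plane} {k : ℕ} (hn : ∀ i, 0 < n i) (S : Set Plane)
    (hside : ∀ i, (n i = 1 ∧ (F.src i ∈ S ↔ F.tgt i ∈ S)) ∨
      (n i = k ∧ F.src i ∈ S ∧ F.tgt i ∉ S ∧ A.SlowArm t k (F.src i) (F.tgt i)))
    {i₀ : ι} (ht : F.src i₀ = t) (htS : t ∉ S) {i₁ : ι} (hs : F.src i₁ ∈ S) :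
    ENNReal.ofReal ((k : ℝ) ^ 2) ≤ A.expectedSteps (F.toGraph n) (F.src i₁) t := by
  classical
  let ψ : Plane → ℝ := fun v => if v ∈ S then (k : ℝ) ^ 2 else 0
  have hψ : ∀ v, 0 ≤ ψ v := fun v => by simp only [ψ]; split_ifs <;> positivity
  have hex : ∀ i, ∃ φ : ℕ → ℝ, φ 0 = ψ (F.src i) ∧ φ (n i) = ψ (F.tgt i) ∧ (∀ j, 0 ≤ φ j) ∧
      ψ (F.src i) - 1 ≤ φ 1 ∧ ψ (F.tgt i) - 1 ≤ φ (n i - 1) ∧ ∀ j, 0 < j → j < n i →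
        φ j ≤ 1 + ∑ w ∈ (F.toGraph n).nbrs (F.node n i j),
          A.moveProb t (F.node n i j) ((F.toGraph n).nbrs (F.node n i j)) w *
            (if w = F.node n i (j + 1) then φ (j + 1) else φ (j - 1)) := by
    intro i
    rcases hside i with ⟨hni, hiff⟩ | ⟨hni, hsrc, htgt, φ, h0, h1, h2, h3, h4⟩
    · have he : ψ (F.tgt i) = ψ (F.src i) := by simp only [ψ, hiff]
      refine ⟨fun _ => ψ (F.src i), rfl, he.symm, fun _ => hψ _, by linarith, by linarith, ?_⟩
      intro j hj0 hj
      omega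
    · have hs : ψ (F.src i) = (k : ℝ) ^ 2 := if_pos hsrc
      have ht : ψ (F.tgt i) = 0 := if_neg htgt
      refine ⟨φ, by rw [h0, hs], by rw [hni, h1, ht], h2, by rw [hs]; exact h3,
        by rw [ht]; linarith [h2 (n i - 1)], fun j hj0 hj => ?_⟩
      have hne : F.node n i (j + 1) ≠ F.node n i (j - 1) := fun he => by
        have := h.node_injective (hn i) he
        omega
      have hnode : ∀ j, armPoint k (F.src i) (F.tgt i) j = F.node n i j := fun j => by
        rw [armPoint, node, hni]
      rw [h.nbrs_node hn hj0 hj, Finset.sum_pair hne, if_pos rfl, if_neg hne.symm]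
      have := h4 j hj0 (by omega)
      simp only [hnode] at this
      linarith
  choose φ h0 h1 h2 h3 h4 h5 using hex
  obtain ⟨Φ, hΦ⟩ := h.exists_glue hn ψ φ h0 h1
  have hsrc : ∀ i, Φ (F.src i) = ψ (F.src i) := fun i => by
    rw [← h0, ← hΦ i 0 (Nat.zero_le _), node_zero]
  have hmem : ∀ i, F.src i ∈ (F.toGraph n).verts := fun i => by
    simpa only [node_zero] using node_mem_verts (F := F) (n := n) (i := i) (Nat.zero_le _)
  have hΦs : Φ (F.src i₁) = (k : ℝ) ^ 2 := by rw [hsrc]; exact if_pos hs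
  rw [← hΦs]
  have hN := h.nbrs_nonempty hn
  refine A.ofReal_le_expectedSteps_of_potential hN (by rw [← ht]; exact hmem i₀) Φ ?_ ?_ ?_
    (hmem i₁)
  · intro v hv
    obtain ⟨i, j, hj, rfl⟩ := mem_verts.1 hv
    rw [hΦ i j hj]
    exact h2 i j
  · rw [← ht, hsrc, ht]
    exact if_neg htS
  · -- At a corner the potential of a neighbour is never smaller by more than one.
    have hcorner : ∀ v ∈ (F.toGraph n).verts, v ≠ t →
        (∀ w ∈ (F.toGraph n).nbrs v, Φ v - 1 ≤ Φ w) → Φ v ≤ 1 +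
          ∑ w ∈ (F.toGraph n).nbrs v, A.moveProb t v ((F.toGraph n).nbrs v) w * Φ w := by
      intro v hv hvt hw
      have h6 : ∑ w ∈ (F.toGraph n).nbrs v, A.moveProb t v ((F.toGraph n).nbrs v) w * (Φ v - 1) ≤
          ∑ w ∈ (F.toGraph n).nbrs v, A.moveProb t v ((F.toGraph n).nbrs v) w * Φ w :=
        Finset.sum_le_sum fun w hwn =>
          mul_le_mul_of_nonneg_left (hw w hwn) (A.moveProb_nonneg _ _ _ _)
      rw [← Finset.sum_mul, A.sum_moveProb (hN v hv) hvt, one_mul] at h6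
      linarith
    intro v hv hvt
    by_cases hint : ∃ i j, 0 < j ∧ j < n i ∧ F.node n i j = v
    · obtain ⟨i, j, hj0, hj, rfl⟩ := hint
      rw [hΦ i j hj.le]
      refine (h5 i j hj0 hj).trans_eq ?_
      congr 1
      refine Finset.sum_congr rfl fun w hw => ?_
      rw [h.nbrs_node hn hj0 hj, Finset.mem_insert, Finset.mem_singleton] at hw
      congr 1
      by_cases hw' : w = F.node n i (j + 1)
      · rw [if_pos hw', hw', hΦ i _ hj]
      · rw [if_neg hw', hw.resolve_left hw', hΦ i _ (by omega)]
    · refine hcorner v hv hvt fun w hw => ?_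
      push Not at hint
      rcases (adj_iff.1 (mem_nbrs.1 hw)).2 with ⟨i, j, hj, hvj, rfl⟩ | ⟨i, j, hj, rfl, hvj⟩
      · have hj0 : j = 0 := by
          by_contra hne
          exact hint i j (Nat.pos_of_ne_zero hne) hj hvj.symm
        subst hj0
        rw [hvj, hΦ i 0 (Nat.zero_le _), hΦ i _ hj, h0]
        exact h3 i
      · have hj1 : j + 1 = n i := by
          by_contra hne
          exact hint i (j + 1) j.succ_pos (by omega) hvj.symm
        rw [hvj, hΦ i _ hj, hΦ i _ hj.le]
        have h6 := h4 i
        rw [← h1, ← hj1] at h6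
        exact h6

end Frame

/-! ### Faces of a drawing -/

/-- The condition on the faces in the definition of a convex subdivision, for a drawing `D`. -/
def HasConvexFaces (D : Set Plane) : Prop :=
  ∀ x ∈ Dᶜ,
    (Bornology.IsBounded (connectedComponentIn Dᶜ x) →
      ∃ P, IsConvexPolygon P ∧ connectedComponentIn Dᶜ x = interior P) ∧
    (¬ Bornology.IsBounded (connectedComponentIn Dᶜ x) →
      ∃ P, IsConvexPolygon P ∧ connectedComponentIn Dᶜ x = Pᶜ)

lemma Frame.Proper.isConvexSubdivision {ι : Type} [Fintype ι] {F : Frame ι} {n : ι → ℕ}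
    (h : F.Proper) (hn : ∀ i, 0 < n i) (hF : HasConvexFaces F.carrier) :
    (F.toGraph n).IsConvexSubdivision where
  isPlane := h.isPlane hn
  connected := h.reachable hn
  inner_face := by
    rintro _ ⟨x, hx, rfl⟩ hb
    rw [h.drawing_toGraph hn] at *
    exact (hF x hx).1 hb
  outer_face := by
    rintro _ ⟨x, hx, rfl⟩ hb
    rw [h.drawing_toGraph hn] at *
    exact (hF x hx).2 hb

lemma connectedComponentIn_eq_of_isOpen {E : Type*} [TopologicalSpace E] {s U V : Set E} {x : E}
    (hU : IsOpen U) (hV : IsOpen V) (hUV : Disjoint U V) (hc : IsPreconnected U) (hUs : U ⊆ s)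
    (hs : s ⊆ U ∪ V) (hx : x ∈ U) : connectedComponentIn s x = U := by
  apply Set.Subset.antisymm
  · exact isPreconnected_connectedComponentIn.subset_left_of_subset_union hU hV hUV
      ((connectedComponentIn_subset s x).trans hs) ⟨x, mem_connectedComponentIn (hUs hx), hx⟩
  · exact hc.subset_connectedComponentIn hx hUs

lemma IsConvexPolygon.convex {P : Set Plane} (h : IsConvexPolygon P) : Convex ℝ P := by
  obtain ⟨⟨S, rfl⟩, -⟩ := h
  exact convex_convexHull ℝ _

lemma IsConvexPolygon.isCompact {P : Set Plane} (h : IsConvexPolygon P) : IsCompact P := by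
  obtain ⟨⟨S, rfl⟩, -⟩ := h
  exact S.finite_toSet.isCompact_convexHull (𝕜 := ℝ)

/-- A drawing inside a convex polygon `P` whose complement in `P` is the disjoint union of the
interiors of convex polygons `Q i` has convex faces. -/
lemma hasConvexFaces_of_cover {κ : Type*} {D P : Set Plane} {Q : κ → Set Plane}
    (hP : IsConvexPolygon P) (hPc : IsPreconnected Pᶜ) (hQ : ∀ i, IsConvexPolygon (Q i))
    (hDP : D ⊆ P) (hQP : ∀ i, interior (Q i) ⊆ P)
    (hdisj : ∀ i j, i ≠ j → Disjoint (interior (Q i)) (interior (Q j)))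
    (hDQ : ∀ i, Disjoint D (interior (Q i)))
    (hcover : ∀ x ∈ P, x ∈ D ∨ ∃ i, x ∈ interior (Q i)) : HasConvexFaces D := by
  have hPopen : IsOpen Pᶜ := hP.isCompact.isClosed.isOpen_compl
  have hPbdd : ¬ Bornology.IsBounded Pᶜ := fun hb => by
    have := hP.isCompact.isBounded.union hb
    rw [Set.union_compl_self] at this
    exact NormedSpace.unbounded_univ ℝ Plane this
  intro x hx
  by_cases hxP : x ∈ P
  · obtain ⟨i, hi⟩ := (hcover x hxP).resolve_left hx
    have hcc : connectedComponentIn Dᶜ x = interior (Q i) := by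
      refine connectedComponentIn_eq_of_isOpen (V := Pᶜ ∪ ⋃ (j) (_ : i ≠ j), interior (Q j))
        isOpen_interior (hPopen.union (isOpen_iUnion fun j => isOpen_iUnion fun _ =>
          isOpen_interior)) ?_ (hQ i).convex.interior.isPreconnected
        (hDQ i).symm.subset_compl_right ?_ hi
      · rw [Set.disjoint_union_right, Set.disjoint_iUnion₂_right]
        exact ⟨Set.disjoint_compl_right_iff_subset.2 (hQP i), fun j hj => hdisj i j hj⟩
      · intro y hy
        by_cases hyP : y ∈ P
        · obtain ⟨j, hj⟩ := (hcover y hyP).resolve_left hy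
          by_cases hij : i = j
          · exact Or.inl (hij ▸ hj)
          · exact Or.inr (Or.inr (Set.mem_iUnion₂.2 ⟨j, hij, hj⟩))
        · exact Or.inr (Or.inl hyP)
    rw [hcc]
    exact ⟨fun _ => ⟨Q i, hQ i, rfl⟩,
      fun hb => (hb ((hQ i).isCompact.isBounded.subset interior_subset)).elim⟩
  · have hcc : connectedComponentIn Dᶜ x = Pᶜ := by
      refine connectedComponentIn_eq_of_isOpen (V := ⋃ j, interior (Q j)) hPopen
        (isOpen_iUnion fun j => isOpen_interior) ?_ hPc (Set.compl_subset_compl.2 hDP) ?_ hxP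
      · rw [Set.disjoint_iUnion_right]
        exact fun j => Set.disjoint_compl_left_iff_subset.2 (hQP j)
      · intro y hy
        by_cases hyP : y ∈ P
        · exact Or.inr (Set.mem_iUnion.2 ((hcover y hyP).resolve_left hy))
        · exact Or.inl hyP
    rw [hcc]
    exact ⟨fun hb => (hPbdd hb).elim, fun _ => ⟨P, hP, rfl⟩⟩

/-! ### Linear images of drawings -/

section Linear

variable (e : Plane ≃L[ℝ] Plane)

lemma IsConvexPolygon.image {P : Set Plane} (h : IsConvexPolygon P) : IsConvexPolygon (e '' P) := by
  classical
  obtain ⟨⟨S, rfl⟩, hne⟩ := h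
  refine ⟨⟨S.image e, ?_⟩, ?_⟩
  · rw [Finset.coe_image]
    exact (e : Plane →ₗ[ℝ] Plane).image_convexHull _
  · rw [← e.coe_toHomeomorph, ← Homeomorph.image_interior]
    exact hne.image _

lemma isBounded_image_iff {s : Set Plane} :
    Bornology.IsBounded (e '' s) ↔ Bornology.IsBounded s := by
  refine ⟨fun h => ?_, fun h => e.lipschitz.isBounded_image h⟩
  have := e.symm.lipschitz.isBounded_image h
  rwa [e.symm_image_image] at this

lemma HasConvexFaces.image {D : Set Plane} (h : HasConvexFaces D) : HasConvexFaces (e '' D) := by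
  intro y hy
  obtain ⟨x, rfl⟩ := e.surjective y
  have hx : x ∈ Dᶜ := fun hxD => hy (Set.mem_image_of_mem e hxD)
  have hcompl : ∀ s : Set Plane, (e '' s)ᶜ = e '' sᶜ := fun s =>
    (Set.image_compl_eq e.bijective).symm
  have hcc : connectedComponentIn (e '' D)ᶜ (e x) = e '' connectedComponentIn Dᶜ x := by
    rw [hcompl]
    exact (e.toHomeomorph.image_connectedComponentIn hx).symm
  rw [hcc, isBounded_image_iff]
  refine ⟨fun hb => ?_, fun hb => ?_⟩
  · obtain ⟨P, hP, he⟩ := (h x hx).1 hb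
    refine ⟨e '' P, hP.image e, ?_⟩
    rw [he]
    exact e.toHomeomorph.image_interior P
  · obtain ⟨P, hP, he⟩ := (h x hx).2 hb
    exact ⟨e '' P, hP.image e, by rw [he, hcompl]⟩

namespace Frame

variable {ι : Type} (F : Frame ι)

/-- The image of a drawing under a linear automorphism of the plane. -/
def map : Frame ι := ⟨fun i => e (F.src i), fun i => e (F.tgt i)⟩

lemma segment_image (p q : Plane) : segment ℝ (e p) (e q) = e '' segment ℝ p q :=
  (_root_.image_segment ℝ (e : Plane →ₗ[ℝ] Plane).toAffineMap p q).symm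

lemma carrier_map : (F.map e).carrier = e '' F.carrier := by
  simp only [carrier, map, segment_image, Set.image_iUnion]

variable {F}

lemma Proper.map (h : F.Proper) : (F.map e).Proper where
  ne i := fun he => h.ne i (e.injective he)
  inter := by
    intro i j hij y hy hy'
    simp only [Frame.map, segment_image] at *
    obtain ⟨x, hx, rfl⟩ := hy
    have hx' := (e.injective.mem_set_image).1 hy'
    exact (h.inter i j hij x hx hx').imp (congrArg e) (congrArg e)
  conn := fun i₀ X h0 hX => h.conn i₀ (e ⁻¹' X) h0 hX

end Frame

end Linear

/-! ### Triangles and segments in coordinates -/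

/-- The point with coordinates `a` and `b`. -/
noncomputable abbrev pt (a b : ℝ) : Plane := !₂[a, b]

/-- Twice the signed area of the triangle `p q x`. -/
def area (p q x : Plane) : ℝ := (q 0 - p 0) * (x 1 - p 1) - (q 1 - p 1) * (x 0 - p 0)

/-- The inner product of `q - p` and `x - p`. -/
def along (p q x : Plane) : ℝ := (q 0 - p 0) * (x 0 - p 0) + (q 1 - p 1) * (x 1 - p 1)

lemma plane_ext {x y : Plane} (h0 : x 0 = y 0) (h1 : x 1 = y 1) : x = y := by
  ext i
  fin_cases i
  · exact h0
  · exact h1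

lemma area_convexComb (p q x y : Plane) {a b : ℝ} (hab : a + b = 1) :
    area p q (a • x + b • y) = a * area p q x + b * area p q y := by
  obtain rfl : b = 1 - a := by linarith
  simp only [area, PiLp.add_apply, PiLp.smul_apply, smul_eq_mul]
  ring

lemma continuous_area (p q : Plane) : Continuous (area p q) := by
  unfold area
  fun_prop

lemma convex_area_nonneg (p q : Plane) : Convex ℝ {x | 0 ≤ area p q x} := by
  intro x hx y hy a b ha hb hab
  change 0 ≤ area p q _
  rw [area_convexComb p q x y hab]
  exact add_nonneg (mul_nonneg ha hx) (mul_nonneg hb hy)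

lemma convex_area_neg (p q : Plane) : Convex ℝ {x | area p q x < 0} := by
  intro x hx y hy a b ha hb hab
  change area p q _ < 0
  rw [area_convexComb p q x y hab]
  change area p q x < 0 at hx
  change area p q y < 0 at hy
  rcases ha.lt_or_eq with ha' | rfl
  · nlinarith [mul_pos_of_neg_of_neg (neg_lt_zero.2 ha') hx,
      mul_nonneg hb (neg_nonneg.2 hy.le)]
  · rw [zero_add] at hab
    simpa [hab] using hy

lemma interior_area_nonneg {p q : Plane} (hpq : p ≠ q) :
    interior {x | 0 ≤ area p q x} = {x | 0 < area p q x} := by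
  apply Set.Subset.antisymm
  · intro x hx
    let d : Plane := pt (q 1 - p 1) (-(q 0 - p 0))
    have hlen : 0 < (q 0 - p 0) ^ 2 + (q 1 - p 1) ^ 2 := by
      by_contra hle
      have h0 : (q 0 - p 0) ^ 2 = 0 := by
        nlinarith [sq_nonneg (q 0 - p 0), sq_nonneg (q 1 - p 1)]
      have h1 : (q 1 - p 1) ^ 2 = 0 := by
        nlinarith [sq_nonneg (q 0 - p 0), sq_nonneg (q 1 - p 1)]
      exact hpq (plane_ext (by linarith [pow_eq_zero_iff (two_ne_zero) |>.1 h0])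
        (by linarith [pow_eq_zero_iff (two_ne_zero) |>.1 h1]))
    have hcont : Continuous fun s : ℝ => x + s • d := by fun_prop
    have hev : ∀ᶠ s : ℝ in nhds 0, 0 ≤ area p q (x + s • d) := by
      have : interior {x | 0 ≤ area p q x} ∈ nhds (x + (0 : ℝ) • d) := by
        rw [zero_smul, add_zero]
        exact isOpen_interior.mem_nhds hx
      filter_upwards [hcont.continuousAt this] with s hs
      exact interior_subset (s := {x | 0 ≤ area p q x}) hs
    obtain ⟨ε, hε, hball⟩ := Metric.eventually_nhds_iff.1 hev
    have h1 := hball (y := ε / 2) (by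
      rw [Real.dist_eq, sub_zero, abs_of_pos (by positivity)]
      linarith)
    have h2 : area p q (x + (ε / 2) • d) =
        area p q x - ε / 2 * ((q 0 - p 0) ^ 2 + (q 1 - p 1) ^ 2) := by
      simp [area, d]
      ring
    have h3 : 0 < ε / 2 * ((q 0 - p 0) ^ 2 + (q 1 - p 1) ^ 2) := by positivity
    change 0 < area p q x
    linarith
  · refine interior_maximal (Set.ofPred_subset_ofPred.2 fun x hx => le_of_lt hx)
      (isOpen_lt continuous_const (continuous_area p q))

lemma mem_segment_iff_area {p q : Plane} (hpq : 0 < along p q q) (x : Plane) :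
    x ∈ segment ℝ p q ↔ area p q x = 0 ∧ 0 ≤ along p q x ∧ along p q x ≤ along p q q := by
  rw [segment_eq_image_lineMap]
  constructor
  · rintro ⟨a, ⟨ha0, ha1⟩, rfl⟩
    have h1 : along p q (AffineMap.lineMap p q a) = a * along p q q := by
      simp [along, AffineMap.lineMap_apply]
      ring
    refine ⟨?_, ?_, ?_⟩
    · simp [area, AffineMap.lineMap_apply]
      ring
    · rw [h1]
      positivity
    · rw [h1]
      nlinarith
  · rintro ⟨h0, h1, h2⟩
    refine ⟨along p q x / along p q q, ⟨by positivity, div_le_one_of_le₀ h2 hpq.le⟩, ?_⟩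
    unfold area at h0
    refine plane_ext ?_ ?_
    · have h3 : x 0 - p 0 = along p q x * (q 0 - p 0) / along p q q := by
        rw [eq_div_iff hpq.ne']
        unfold along
        linear_combination (-(q 1 - p 1)) * h0
      simp only [AffineMap.lineMap_apply, vsub_eq_sub, vadd_eq_add, PiLp.add_apply,
        PiLp.smul_apply, PiLp.sub_apply, smul_eq_mul]
      rw [div_mul_eq_mul_div, ← h3]
      ring
    · have h3 : x 1 - p 1 = along p q x * (q 1 - p 1) / along p q q := by
        rw [eq_div_iff hpq.ne']
        unfold along
        linear_combination (q 0 - p 0) * h0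
      simp only [AffineMap.lineMap_apply, vsub_eq_sub, vadd_eq_add, PiLp.add_apply,
        PiLp.smul_apply, PiLp.sub_apply, smul_eq_mul]
      rw [div_mul_eq_mul_div, ← h3]
      ring

lemma ne_of_area_pos {p q r : Plane} (h : 0 < area p q r) : p ≠ q := by
  rintro rfl
  simp [area] at h

lemma area_rotate (p q r : Plane) : area q r p = area p q r := by
  unfold area
  ring

/-- A triangle is the intersection of three half-planes. -/
lemma convexHull_triangle {p q r : Plane} (h : 0 < area p q r) :
    convexHull ℝ {p, q, r} =
      {x | 0 ≤ area p q x} ∩ {x | 0 ≤ area q r x} ∩ {x | 0 ≤ area r p x} := by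
  apply Set.Subset.antisymm
  · refine convexHull_min ?_ (((convex_area_nonneg p q).inter (convex_area_nonneg q r)).inter
      (convex_area_nonneg r p))
    have h2 := area_rotate p q r
    have h3 := area_rotate q r p
    have hz : ∀ u v : Plane, area u v u = 0 ∧ area u v v = 0 := fun u v => by
      constructor <;> unfold area <;> ring
    rintro x (rfl | rfl | rfl)
    · exact ⟨⟨(hz _ _).1.ge, by change 0 ≤ area _ _ _; linarith⟩, (hz _ _).2.ge⟩
    · exact ⟨⟨(hz _ _).2.ge, (hz _ _).1.ge⟩, by change 0 ≤ area _ _ _; linarith⟩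
    · exact ⟨⟨h.le, (hz _ _).2.ge⟩, (hz _ _).1.ge⟩
  · rintro x ⟨⟨h1, h2⟩, h3⟩
    change 0 ≤ area _ _ _ at h1 h2 h3
    have hsum : area p q x + area q r x + area r p x = area p q r := by unfold area; ring
    have hx : x = (area q r x / area p q r) • p + (area r p x / area p q r) • q +
        (area p q x / area p q r) • r := by
      have hne := h.ne'
      unfold area at hne
      refine plane_ext ?_ ?_ <;>
      · simp only [PiLp.add_apply, PiLp.smul_apply, smul_eq_mul, area]
        field_simp
        ring
    rw [hx]
    refine (convex_convexHull ℝ _).sum_mem (t := Finset.univ)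
      (w := ![area q r x / area p q r, area r p x / area p q r, area p q x / area p q r])
      (z := ![p, q, r]) ?_ ?_ ?_ |> fun hm => by simpa [Fin.sum_univ_three] using hm
    · intro i _
      fin_cases i <;> simp <;> positivity
    · simp [Fin.sum_univ_three, ← add_div]
      rw [show area q r x + area r p x + area p q x = area p q r by linarith, div_self h.ne']
    · intro i _
      apply subset_convexHull
      fin_cases i <;> simp

lemma interior_triangle {p q r : Plane} (h : 0 < area p q r) :
    interior (convexHull ℝ {p, q, r}) =
      {x | 0 < area p q x} ∩ {x | 0 < area q r x} ∩ {x | 0 < area r p x} := by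
  have h2 := area_rotate p q r
  have h3 := area_rotate q r p
  rw [convexHull_triangle h, interior_inter, interior_inter,
    interior_area_nonneg (ne_of_area_pos h), interior_area_nonneg (ne_of_area_pos (h2 ▸ h)),
    interior_area_nonneg (ne_of_area_pos (h3 ▸ h2 ▸ h))]

lemma isConvexPolygon_triangle {p q r : Plane} (h : 0 < area p q r) :
    IsConvexPolygon (convexHull ℝ {p, q, r}) := by
  classical
  refine ⟨⟨{p, q, r}, by simp⟩, (1 / 3 : ℝ) • (p + q + r), ?_⟩
  rw [interior_triangle h]
  have h1 : ∀ u v w : Plane, area u v ((1 / 3 : ℝ) • (u + v + w)) = area u v w / 3 := by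
    intro u v w
    simp [area]
    ring
  have h2 := area_rotate p q r
  have h3 := area_rotate q r p
  refine ⟨⟨?_, ?_⟩, ?_⟩
  · change 0 < area _ _ _
    rw [h1]
    linarith
  · change 0 < area _ _ _
    rw [show p + q + r = q + r + p by abel, h1]
    linarith
  · change 0 < area _ _ _
    rw [show p + q + r = r + p + q by abel, h1]
    linarith

/-- The complement of a triangle is a chain of overlapping half-planes. -/
lemma isPreconnected_compl_triangle {p q r : Plane} (h : 0 < area p q r) :
    IsPreconnected (convexHull ℝ {p, q, r})ᶜ := by
  have hcompl : (convexHull ℝ {p, q, r})ᶜ =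
      {x | area p q x < 0} ∪ {x | area q r x < 0} ∪ {x | area r p x < 0} := by
    rw [convexHull_triangle h, Set.compl_inter, Set.compl_inter]
    simp only [Set.compl_ofPred, not_le]
  -- The point opposite to `p` across `q` lies beyond the sides `p q` and `q r`, and so on.
  have hw : ∀ u v w : Plane, 0 < area u v w →
      area u v ((3 : ℝ) • v - u - w) < 0 ∧ area v w ((3 : ℝ) • v - u - w) < 0 := by
    intro u v w huvw
    have h1 : area u v ((3 : ℝ) • v - u - w) = - area u v w := by
      simp [area]
      ring
    have h2 : area v w ((3 : ℝ) • v - u - w) = - area u v w := by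
      simp [area]
      ring
    rw [h1, h2]
    exact ⟨by linarith, by linarith⟩
  have h2 := area_rotate p q r
  have h3 := area_rotate q r p
  rw [hcompl]
  have a1 := hw p q r h
  have a2 := hw q r p (by linarith)
  refine IsPreconnected.union _ (Or.inr a2.1) a2.2 (IsPreconnected.union _ a1.1 a1.2 ?_ ?_) ?_
  all_goals exact (convex_area_neg _ _).isPreconnected

lemma area_of_mem_segment {p q x : Plane} (hx : x ∈ segment ℝ p q) :
    area p q x = 0 ∧ 0 ≤ along p q x ∧ along p q x ≤ along p q q := by
  by_cases hpq : 0 < along p q q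
  · exact (mem_segment_iff_area hpq x).1 hx
  · have h0 : p = q := by
      unfold along at hpq
      refine plane_ext ?_ ?_ <;> nlinarith [sq_nonneg (q 0 - p 0), sq_nonneg (q 1 - p 1)]
    subst h0
    simp only [segment_same, Set.mem_singleton_iff] at hx
    subst hx
    simp [area, along]

/-- A drawing that covers exactly the boundary of a convex polygon has convex faces. -/
lemma hasConvexFaces_of_boundary {D P : Set Plane} (hP : IsConvexPolygon P)
    (hPc : IsPreconnected Pᶜ) (hDP : D ⊆ P) (hDQ : Disjoint D (interior P))
    (hcover : ∀ x ∈ P, x ∈ D ∨ x ∈ interior P) : HasConvexFaces D :=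
  hasConvexFaces_of_cover (κ := Unit) (Q := fun _ => P) hP hPc (fun _ => hP) hDP
    (fun _ => interior_subset) (fun _ _ h => (h rfl).elim) (fun _ => hDQ)
    fun x hx => (hcover x hx).imp_right fun h => ⟨(), h⟩

lemma mem_carrier_of_pt {ι : Type} {F : Frame ι} {x : Plane} (i : ι) {a b c d : ℝ}
    (hs : F.src i = pt a b) (ht : F.tgt i = pt c d) (hi : 0 < (c - a) ^ 2 + (d - b) ^ 2)
    (h0 : (c - a) * (x 1 - b) = (d - b) * (x 0 - a))
    (h1 : 0 ≤ (c - a) * (x 0 - a) + (d - b) * (x 1 - b))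
    (h2 : (c - a) * (x 0 - a) + (d - b) * (x 1 - b) ≤ (c - a) ^ 2 + (d - b) ^ 2) :
    x ∈ F.carrier := by
  refine Set.mem_iUnion.2 ⟨i, ?_⟩
  rw [hs, ht, mem_segment_iff_area (by simpa [along, ← sq] using hi)]
  simp only [area, along, ← sq]
  exact ⟨sub_eq_zero.2 h0, h1, h2⟩

/-! ### A triangle with two arms on one of its sides -/

/-- The triangle with corners `(0, 0)`, `(2, -1)`, `(-1, 2)`, with the points `(1, 0)` and `(0, 1)`
on the side opposite to the origin. The sides `0` and `2` are the arms, directed outwards from these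
two points. -/
noncomputable def triangleFrame : Frame (Fin 5) where
  src := ![pt 1 0, pt 1 0, pt 0 1, pt (-1) 2, pt 0 0]
  tgt := ![pt 2 (-1), pt 0 1, pt (-1) 2, pt 0 0, pt 2 (-1)]

lemma triangleFrame_proper : triangleFrame.Proper where
  ne := by
    intro i h
    have h' := And.intro (congrArg (fun v : Plane => v 0) h) (congrArg (fun v : Plane => v 1) h)
    fin_cases i <;> norm_num [triangleFrame] at h'
  inter := by
    intro i j hij x hx hx'
    have h := area_of_mem_segment hx
    have h' := area_of_mem_segment hx'
    fin_cases i <;> fin_cases j <;> first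
      | exact (hij rfl).elim
      | (norm_num [triangleFrame, area, along] at h h'; first
          | (exfalso; linarith)
          | (left; refine plane_ext ?_ ?_ <;> norm_num [triangleFrame] <;> linarith)
          | (right; refine plane_ext ?_ ?_ <;> norm_num [triangleFrame] <;> linarith))
  conn := by
    intro i₀ X h0 hX
    have h1 := hX 0
    have h2 := hX 1
    have h3 := hX 2
    have h4 := hX 3
    have h5 := hX 4
    simp [triangleFrame] at h1 h2 h3 h4 h5
    intro i
    fin_cases i₀ <;> fin_cases i <;> simp [triangleFrame] at h0 ⊢ <;> tauto

lemma triangleFrame_hasConvexFaces : HasConvexFaces triangleFrame.carrier := by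
  have harea : 0 < area (pt 0 0) (pt 2 (-1)) (pt (-1) 2) := by norm_num [area]
  refine hasConvexFaces_of_boundary (isConvexPolygon_triangle harea)
    (isPreconnected_compl_triangle harea) ?_ ?_ ?_
  · rw [convexHull_triangle harea]
    intro x hx
    obtain ⟨i, hi⟩ := Set.mem_iUnion.1 hx
    have h := area_of_mem_segment hi
    simp only [Set.mem_inter_iff, Set.mem_ofPred_eq]
    fin_cases i <;> norm_num [triangleFrame, area, along] at h ⊢ <;>
      refine ⟨⟨?_, ?_⟩, ?_⟩ <;> linarith
  · rw [interior_triangle harea, Set.disjoint_left]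
    rintro x hx ⟨⟨h1, h2⟩, h3⟩
    obtain ⟨i, hi⟩ := Set.mem_iUnion.1 hx
    have h := area_of_mem_segment hi
    simp only [Set.mem_ofPred_eq] at h1 h2 h3
    fin_cases i <;> norm_num [triangleFrame, area, along] at h h1 h2 h3 <;> linarith
  · rw [interior_triangle harea, convexHull_triangle harea]
    rintro x ⟨⟨h1, h2⟩, h3⟩
    simp only [Set.mem_inter_iff, Set.mem_ofPred_eq] at h1 h2 h3 ⊢
    rcases h1.lt_or_eq with h1' | h1'
    rcases h2.lt_or_eq with h2' | h2'
    rcases h3.lt_or_eq with h3' | h3'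
    · exact Or.inr ⟨⟨h1', h2'⟩, h3'⟩
    all_goals
      left
      norm_num [area] at h1 h2 h3
    · norm_num [area] at h3'
      refine mem_carrier_of_pt 3 rfl rfl (by norm_num) ?_ ?_ ?_ <;> linarith
    · norm_num [area] at h2'
      rcases le_total (x 0) 0 with hx | hx
      · refine mem_carrier_of_pt 2 rfl rfl (by norm_num) ?_ ?_ ?_ <;> linarith
      rcases le_total (x 1) 0 with hy | hy
      · refine mem_carrier_of_pt 0 rfl rfl (by norm_num) ?_ ?_ ?_ <;> linarith
      · refine mem_carrier_of_pt 1 rfl rfl (by norm_num) ?_ ?_ ?_ <;> linarith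
    · norm_num [area] at h1'
      refine mem_carrier_of_pt 4 rfl rfl (by norm_num) ?_ ?_ ?_ <;> linarith

/-! ### A pentagon with two arms among its sides -/

/-- The convex pentagon with corners `(0, 0)`, `(1, 0)`, `(3, 1)`, `(1, 3)`, `(0, 1)`.
The sides `0` and `2` are the arms, directed towards `(1, 0)` and `(0, 1)`. -/
noncomputable def pentagonFrame : Frame (Fin 5) where
  src := ![pt 3 1, pt 3 1, pt 1 3, pt 0 1, pt 0 0]
  tgt := ![pt 1 0, pt 1 3, pt 0 1, pt 0 0, pt 1 0]

lemma pentagonFrame_proper : pentagonFrame.Proper where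
  ne := by
    intro i h
    have h' := And.intro (congrArg (fun v : Plane => v 0) h) (congrArg (fun v : Plane => v 1) h)
    fin_cases i <;> norm_num [pentagonFrame] at h'
  inter := by
    intro i j hij x hx hx'
    have h := area_of_mem_segment hx
    have h' := area_of_mem_segment hx'
    fin_cases i <;> fin_cases j <;> first
      | exact (hij rfl).elim
      | (norm_num [pentagonFrame, area, along] at h h'; first
          | (exfalso; linarith)
          | (left; refine plane_ext ?_ ?_ <;> norm_num [pentagonFrame] <;> linarith)
          | (right; refine plane_ext ?_ ?_ <;> norm_num [pentagonFrame] <;> linarith))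
  conn := by
    intro i₀ X h0 hX
    have h1 := hX 0
    have h2 := hX 1
    have h3 := hX 2
    have h4 := hX 3
    have h5 := hX 4
    simp [pentagonFrame] at h1 h2 h3 h4 h5
    intro i
    fin_cases i₀ <;> fin_cases i <;> simp [pentagonFrame] at h0 ⊢ <;> tauto

/-- The region bounded by `pentagonFrame`. -/
noncomputable def pentagon : Set Plane := convexHull ℝ {pt 0 0, pt 1 0, pt 3 1, pt 1 3, pt 0 1}

lemma pentagon_eq : pentagon = {x | 0 ≤ area (pt 0 0) (pt 1 0) x} ∩
    {x | 0 ≤ area (pt 1 0) (pt 3 1) x} ∩ {x | 0 ≤ area (pt 3 1) (pt 1 3) x} ∩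
    {x | 0 ≤ area (pt 1 3) (pt 0 1) x} ∩ {x | 0 ≤ area (pt 0 1) (pt 0 0) x} := by
  apply Set.Subset.antisymm
  · refine convexHull_min ?_ (((((convex_area_nonneg _ _).inter (convex_area_nonneg _ _)).inter
      (convex_area_nonneg _ _)).inter (convex_area_nonneg _ _)).inter (convex_area_nonneg _ _))
    rintro x (rfl | rfl | rfl | rfl | rfl) <;> norm_num [area]
  · rintro x ⟨⟨⟨⟨h1, h2⟩, h3⟩, h4⟩, h5⟩
    have a1 : 0 < area (pt 0 0) (pt 1 0) (pt 3 1) := by norm_num [area]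
    have a2 : 0 < area (pt 0 0) (pt 3 1) (pt 1 3) := by norm_num [area]
    have a3 : 0 < area (pt 0 0) (pt 1 3) (pt 0 1) := by norm_num [area]
    -- The diagonals from the origin split the pentagon into three triangles.
    have key : x ∈ convexHull ℝ {pt 0 0, pt 1 0, pt 3 1} ∨
        x ∈ convexHull ℝ {pt 0 0, pt 3 1, pt 1 3} ∨ x ∈ convexHull ℝ {pt 0 0, pt 1 3, pt 0 1} := by
      rw [convexHull_triangle a1, convexHull_triangle a2, convexHull_triangle a3]
      simp only [Set.mem_inter_iff, Set.mem_ofPred_eq]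
      norm_num [area] at h1 h2 h3 h4 h5 ⊢
      rcases le_total (3 * x 1) (x 0) with hd | hd
      · left
        refine ⟨⟨?_, ?_⟩, ?_⟩ <;> linarith
      rcases le_total (x 1) (3 * x 0) with hd' | hd'
      · right; left
        refine ⟨⟨?_, ?_⟩, ?_⟩ <;> linarith
      · right; right
        refine ⟨⟨?_, ?_⟩, ?_⟩ <;> linarith
    rcases key with h | h | h <;> refine convexHull_mono ?_ h <;> intro y hy <;>
      simp only [Set.mem_insert_iff, Set.mem_singleton_iff] at hy ⊢ <;> tauto

lemma interior_pentagon : interior pentagon = {x | 0 < area (pt 0 0) (pt 1 0) x} ∩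
    {x | 0 < area (pt 1 0) (pt 3 1) x} ∩ {x | 0 < area (pt 3 1) (pt 1 3) x} ∩
    {x | 0 < area (pt 1 3) (pt 0 1) x} ∩ {x | 0 < area (pt 0 1) (pt 0 0) x} := by
  rw [pentagon_eq, interior_inter, interior_inter, interior_inter, interior_inter,
    interior_area_nonneg (ne_of_area_pos (r := pt 1 1) (by norm_num [area])),
    interior_area_nonneg (ne_of_area_pos (r := pt 1 1) (by norm_num [area])),
    interior_area_nonneg (ne_of_area_pos (r := pt 1 1) (by norm_num [area])),
    interior_area_nonneg (ne_of_area_pos (r := pt 1 1) (by norm_num [area])),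
    interior_area_nonneg (ne_of_area_pos (r := pt 1 1) (by norm_num [area]))]

lemma isConvexPolygon_pentagon : IsConvexPolygon pentagon := by
  classical
  refine ⟨⟨{pt 0 0, pt 1 0, pt 3 1, pt 1 3, pt 0 1}, by simp [pentagon]⟩, pt 1 1, ?_⟩
  rw [interior_pentagon]
  norm_num [area]

lemma isPreconnected_compl_pentagon : IsPreconnected pentagonᶜ := by
  have hcompl : pentagonᶜ = {x | area (pt 0 0) (pt 1 0) x < 0} ∪
      {x | area (pt 1 0) (pt 3 1) x < 0} ∪ {x | area (pt 3 1) (pt 1 3) x < 0} ∪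
      {x | area (pt 1 3) (pt 0 1) x < 0} ∪ {x | area (pt 0 1) (pt 0 0) x < 0} := by
    rw [pentagon_eq, Set.compl_inter, Set.compl_inter, Set.compl_inter, Set.compl_inter]
    simp only [Set.compl_ofPred, not_le]
  have hpre : ∀ p q : Plane, IsPreconnected {x | area p q x < 0} := fun p q =>
    (convex_area_neg p q).isPreconnected
  rw [hcompl]
  refine IsPreconnected.union (pt (-1) (-1)) ?_ ?_ (IsPreconnected.union (pt 1 5) ?_ ?_
    (IsPreconnected.union (pt 5 1) ?_ ?_ (IsPreconnected.union (pt 2 (-1)) ?_ ?_ (hpre _ _)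
      (hpre _ _)) (hpre _ _)) (hpre _ _)) (hpre _ _) <;> norm_num [area]

lemma pentagonFrame_hasConvexFaces : HasConvexFaces pentagonFrame.carrier := by
  refine hasConvexFaces_of_boundary isConvexPolygon_pentagon isPreconnected_compl_pentagon ?_ ?_ ?_
  · rw [pentagon_eq]
    intro x hx
    obtain ⟨i, hi⟩ := Set.mem_iUnion.1 hx
    have h := area_of_mem_segment hi
    simp only [Set.mem_inter_iff, Set.mem_ofPred_eq]
    fin_cases i <;> norm_num [pentagonFrame, area, along] at h ⊢ <;>
      refine ⟨⟨⟨⟨?_, ?_⟩, ?_⟩, ?_⟩, ?_⟩ <;> linarith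
  · rw [interior_pentagon, Set.disjoint_left]
    rintro x hx ⟨⟨⟨⟨h1, h2⟩, h3⟩, h4⟩, h5⟩
    obtain ⟨i, hi⟩ := Set.mem_iUnion.1 hx
    have h := area_of_mem_segment hi
    simp only [Set.mem_ofPred_eq] at h1 h2 h3 h4 h5
    fin_cases i <;> norm_num [pentagonFrame, area, along] at h h1 h2 h3 h4 h5 <;> linarith
  · rw [interior_pentagon, pentagon_eq]
    rintro x ⟨⟨⟨⟨h1, h2⟩, h3⟩, h4⟩, h5⟩
    simp only [Set.mem_inter_iff, Set.mem_ofPred_eq] at h1 h2 h3 h4 h5 ⊢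
    rcases h1.lt_or_eq with h1' | h1'
    rcases h2.lt_or_eq with h2' | h2'
    rcases h3.lt_or_eq with h3' | h3'
    rcases h4.lt_or_eq with h4' | h4'
    rcases h5.lt_or_eq with h5' | h5'
    · exact Or.inr ⟨⟨⟨⟨h1', h2'⟩, h3'⟩, h4'⟩, h5'⟩
    all_goals
      left
      norm_num [area] at h1 h2 h3 h4 h5
    · norm_num [area] at h5'
      refine mem_carrier_of_pt 3 rfl rfl (by norm_num) ?_ ?_ ?_ <;> linarith
    · norm_num [area] at h4'
      refine mem_carrier_of_pt 2 rfl rfl (by norm_num) ?_ ?_ ?_ <;> linarith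
    · norm_num [area] at h3'
      refine mem_carrier_of_pt 1 rfl rfl (by norm_num) ?_ ?_ ?_ <;> linarith
    · norm_num [area] at h2'
      refine mem_carrier_of_pt 0 rfl rfl (by norm_num) ?_ ?_ ?_ <;> linarith
    · norm_num [area] at h1'
      refine mem_carrier_of_pt 4 rfl rfl (by norm_num) ?_ ?_ ?_ <;> linarith

/-! ### The pinwheel -/

/-- The pinwheel: an inner triangle `(1, 0)`, `(0, 1)`, `(-1, -1)`, joined to the origin in its
interior, each of whose sides is prolonged at one end to a corner of an outer triangle
`(3, 1)`, `(-1, 2)`, `(-2, -3)`. The sides `0`, `1`, `2` are the arms between the two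
triangles, directed inwards. -/
noncomputable def pinwheelFrame : Frame (Fin 12) where
  src := ![pt 3 1, pt (-1) 2, pt (-2) (-3), pt 3 1, pt (-1) 2, pt (-2) (-3),
    pt 1 0, pt 0 1, pt (-1) (-1), pt 0 0, pt 0 0, pt 0 0]
  tgt := ![pt 1 0, pt 0 1, pt (-1) (-1), pt (-1) 2, pt (-2) (-3), pt 3 1,
    pt 0 1, pt (-1) (-1), pt 1 0, pt 1 0, pt 0 1, pt (-1) (-1)]

set_option maxHeartbeats 4000000 in
lemma pinwheelFrame_inter (i j : Fin 12) (hij : i ≠ j) (x : Plane)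
    (hx : x ∈ segment ℝ (pinwheelFrame.src i) (pinwheelFrame.tgt i))
    (hx' : x ∈ segment ℝ (pinwheelFrame.src j) (pinwheelFrame.tgt j)) :
    x = pinwheelFrame.src i ∨ x = pinwheelFrame.tgt i := by
  have h := area_of_mem_segment hx
  have h' := area_of_mem_segment hx'
  fin_cases i <;> norm_num [pinwheelFrame, area, along] at h <;> fin_cases j <;> first
    | exact (hij rfl).elim
    | (norm_num [pinwheelFrame, area, along] at h'; first
        | (exfalso; linarith)
        | (left; refine plane_ext ?_ ?_ <;> norm_num [pinwheelFrame] <;> linarith)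
        | (right; refine plane_ext ?_ ?_ <;> norm_num [pinwheelFrame] <;> linarith))

lemma pinwheelFrame_proper : pinwheelFrame.Proper where
  ne := by
    intro i h
    have h' := And.intro (congrArg (fun v : Plane => v 0) h) (congrArg (fun v : Plane => v 1) h)
    fin_cases i <;> norm_num [pinwheelFrame] at h'
  inter := pinwheelFrame_inter
  conn := by
    intro i₀ X h0 hX
    have s0 : pt 1 0 ∈ X ↔ pt 0 0 ∈ X := (hX 9).symm
    have s1 : pt 0 1 ∈ X ↔ pt 0 0 ∈ X := (hX 10).symm
    have s2 : pt (-1) (-1) ∈ X ↔ pt 0 0 ∈ X := (hX 11).symm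
    have q0 : pt 3 1 ∈ X ↔ pt 0 0 ∈ X := (hX 0).trans s0
    have q1 : pt (-1) 2 ∈ X ↔ pt 0 0 ∈ X := (hX 1).trans s1
    have q2 : pt (-2) (-3) ∈ X ↔ pt 0 0 ∈ X := (hX 2).trans s2
    have key : ∀ i, pinwheelFrame.src i ∈ X ↔ pt 0 0 ∈ X := by
      intro i
      fin_cases i
      exacts [q0, q1, q2, q0, q1, q2, s0, s1, s2, Iff.rfl, Iff.rfl, Iff.rfl]
    exact fun i => (key i).2 ((key i₀).1 h0)

/-- The corners of the bounded faces of the pinwheel: the three parts of the inner triangle, and the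
three triangles between the inner and the outer triangle. -/
noncomputable def pinwheelFace : Fin 6 → Plane × Plane × Plane :=
  ![(pt 0 0, pt 1 0, pt 0 1), (pt 0 0, pt 0 1, pt (-1) (-1)), (pt 0 0, pt (-1) (-1), pt 1 0),
    (pt 1 0, pt 3 1, pt (-1) 2), (pt 0 1, pt (-1) 2, pt (-2) (-3)),
    (pt (-1) (-1), pt (-2) (-3), pt 3 1)]

lemma area_pinwheelFace_pos (i : Fin 6) :
    0 < area (pinwheelFace i).1 (pinwheelFace i).2.1 (pinwheelFace i).2.2 := by
  fin_cases i <;> norm_num [pinwheelFace, area]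

lemma mem_interior_pinwheelFace (i : Fin 6) (x : Plane) :
    x ∈ interior (convexHull ℝ {(pinwheelFace i).1, (pinwheelFace i).2.1, (pinwheelFace i).2.2}) ↔
      0 < area (pinwheelFace i).1 (pinwheelFace i).2.1 x ∧
      0 < area (pinwheelFace i).2.1 (pinwheelFace i).2.2 x ∧
      0 < area (pinwheelFace i).2.2 (pinwheelFace i).1 x := by
  rw [interior_triangle (area_pinwheelFace_pos i)]
  simp only [Set.mem_inter_iff, Set.mem_ofPred_eq, and_assoc]

lemma pinwheelFrame_cover {x : Plane} (h0 : 0 ≤ 7 - x 0 - 4 * x 1) (h1 : 0 ≤ 7 + 5 * x 0 - x 1)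
    (h2 : 0 ≤ 7 - 4 * x 0 + 5 * x 1) : x ∈ pinwheelFrame.carrier ∨ ∃ i, x ∈ interior (convexHull ℝ
      {(pinwheelFace i).1, (pinwheelFace i).2.1, (pinwheelFace i).2.2}) := by
  have side (i : Fin 12) {a b c d : ℝ} (hs : pinwheelFrame.src i = pt a b)
      (ht : pinwheelFrame.tgt i = pt c d) (hi : 0 < (c - a) ^ 2 + (d - b) ^ 2)
      (h : (c - a) * (x 1 - b) = (d - b) * (x 0 - a) ∧
        0 ≤ (c - a) * (x 0 - a) + (d - b) * (x 1 - b) ∧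
        (c - a) * (x 0 - a) + (d - b) * (x 1 - b) ≤ (c - a) ^ 2 + (d - b) ^ 2) :
      x ∈ pinwheelFrame.carrier ∨ ∃ i, x ∈ interior (convexHull ℝ
        {(pinwheelFace i).1, (pinwheelFace i).2.1, (pinwheelFace i).2.2}) :=
    Or.inl (mem_carrier_of_pt i hs ht hi h.1 h.2.1 h.2.2)
  have face (i : Fin 6) {a b c d p q : ℝ} (hi : pinwheelFace i = (pt a b, pt c d, pt p q))
      (h : 0 < area (pt a b) (pt c d) x ∧ 0 < area (pt c d) (pt p q) x ∧
        0 < area (pt p q) (pt a b) x) :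
      x ∈ pinwheelFrame.carrier ∨ ∃ i, x ∈ interior (convexHull ℝ
        {(pinwheelFace i).1, (pinwheelFace i).2.1, (pinwheelFace i).2.2}) :=
    Or.inr ⟨i, (mem_interior_pinwheelFace i x).2 (by rw [hi]; exact h)⟩
  -- Locate `x` relative to the three lines that carry the sides of the inner triangle.
  by_cases a0 : 1 - x 0 - x 1 < 0
  · rcases lt_trichotomy (1 - x 0 + 2 * x 1) 0 with hl | hl | hl
    · rcases h2.lt_or_eq with h2' | h2'
      · exact face 5 rfl (by norm_num [area]; refine ⟨?_, ?_, ?_⟩ <;> linarith)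
      · exact side 5 rfl rfl (by norm_num) (by refine ⟨?_, ?_, ?_⟩ <;> linarith)
    · exact side 0 rfl rfl (by norm_num) (by refine ⟨?_, ?_, ?_⟩ <;> linarith)
    · rcases h0.lt_or_eq with h0' | h0'
      · exact face 3 rfl (by norm_num [area]; refine ⟨?_, ?_, ?_⟩ <;> linarith)
      · exact side 3 rfl rfl (by norm_num) (by refine ⟨?_, ?_, ?_⟩ <;> linarith)
  by_cases a1 : 1 + 2 * x 0 - x 1 < 0
  · rcases (not_lt.1 a0).lt_or_eq with hl | hl
    · rcases h1.lt_or_eq with h1' | h1'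
      · exact face 4 rfl (by norm_num [area]; refine ⟨?_, ?_, ?_⟩ <;> linarith)
      · exact side 4 rfl rfl (by norm_num) (by refine ⟨?_, ?_, ?_⟩ <;> linarith)
    · exact side 1 rfl rfl (by norm_num) (by refine ⟨?_, ?_, ?_⟩ <;> linarith)
  by_cases a2 : 1 - x 0 + 2 * x 1 < 0
  · rcases (not_lt.1 a1).lt_or_eq with hl | hl
    · rcases h2.lt_or_eq with h2' | h2'
      · exact face 5 rfl (by norm_num [area]; refine ⟨?_, ?_, ?_⟩ <;> linarith)
      · exact side 5 rfl rfl (by norm_num) (by refine ⟨?_, ?_, ?_⟩ <;> linarith)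
    · exact side 2 rfl rfl (by norm_num) (by refine ⟨?_, ?_, ?_⟩ <;> linarith)
  rcases (not_lt.1 a0).lt_or_eq with l0 | l0
  rcases (not_lt.1 a1).lt_or_eq with l1 | l1
  rcases (not_lt.1 a2).lt_or_eq with l2 | l2
  · rcases lt_trichotomy (x 0) 0 with hX | hX | hX
    · rcases lt_trichotomy (x 1) (x 0) with hY | hY | hY
      · exact face 2 rfl (by norm_num [area]; refine ⟨?_, ?_, ?_⟩ <;> linarith)
      · exact side 11 rfl rfl (by norm_num) (by refine ⟨?_, ?_, ?_⟩ <;> linarith)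
      · exact face 1 rfl (by norm_num [area]; refine ⟨?_, ?_, ?_⟩ <;> linarith)
    · rcases lt_or_ge (x 1) 0 with hY | hY
      · exact face 2 rfl (by norm_num [area]; refine ⟨?_, ?_, ?_⟩ <;> linarith)
      · exact side 10 rfl rfl (by norm_num) (by refine ⟨?_, ?_, ?_⟩ <;> linarith)
    · rcases lt_trichotomy (x 1) 0 with hY | hY | hY
      · exact face 2 rfl (by norm_num [area]; refine ⟨?_, ?_, ?_⟩ <;> linarith)
      · exact side 9 rfl rfl (by norm_num) (by refine ⟨?_, ?_, ?_⟩ <;> linarith)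
      · exact face 0 rfl (by norm_num [area]; refine ⟨?_, ?_, ?_⟩ <;> linarith)
  · exact side 8 rfl rfl (by norm_num) (by refine ⟨?_, ?_, ?_⟩ <;> linarith)
  · exact side 7 rfl rfl (by norm_num) (by refine ⟨?_, ?_, ?_⟩ <;> linarith)
  · exact side 6 rfl rfl (by norm_num) (by refine ⟨?_, ?_, ?_⟩ <;> linarith)

set_option maxHeartbeats 4000000 in
lemma disjoint_pinwheelFrame_face (i : Fin 6) : Disjoint pinwheelFrame.carrier
    (interior (convexHull ℝ
      {(pinwheelFace i).1, (pinwheelFace i).2.1, (pinwheelFace i).2.2})) := by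
  rw [Set.disjoint_left]
  intro x hx hxi
  rw [mem_interior_pinwheelFace] at hxi
  obtain ⟨j, hj⟩ := Set.mem_iUnion.1 hx
  have h := area_of_mem_segment hj
  fin_cases i <;> norm_num [pinwheelFace, area] at hxi <;> fin_cases j <;>
    norm_num [pinwheelFrame, area, along] at h <;> linarith

lemma pinwheelFrame_hasConvexFaces : HasConvexFaces pinwheelFrame.carrier := by
  have harea : 0 < area (pt 3 1) (pt (-1) 2) (pt (-2) (-3)) := by norm_num [area]
  refine hasConvexFaces_of_cover (κ := Fin 6) (P := convexHull ℝ {pt 3 1, pt (-1) 2, pt (-2) (-3)})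
    (Q := fun i => convexHull ℝ
      {(pinwheelFace i).1, (pinwheelFace i).2.1, (pinwheelFace i).2.2})
    (isConvexPolygon_triangle harea) (isPreconnected_compl_triangle harea)
    (fun i => isConvexPolygon_triangle (area_pinwheelFace_pos i)) ?_ ?_ ?_
    disjoint_pinwheelFrame_face ?_
  · rw [convexHull_triangle harea]
    intro x hx
    obtain ⟨i, hi⟩ := Set.mem_iUnion.1 hx
    have h := area_of_mem_segment hi
    simp only [Set.mem_inter_iff, Set.mem_ofPred_eq]
    fin_cases i <;> norm_num [pinwheelFrame, area, along] at h ⊢ <;>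
      refine ⟨⟨?_, ?_⟩, ?_⟩ <;> linarith
  · intro i x hx
    rw [mem_interior_pinwheelFace] at hx
    rw [convexHull_triangle harea]
    simp only [Set.mem_inter_iff, Set.mem_ofPred_eq]
    fin_cases i <;> norm_num [pinwheelFace, area] at hx ⊢ <;>
      refine ⟨⟨?_, ?_⟩, ?_⟩ <;> linarith
  · intro i j hij
    rw [Set.disjoint_left]
    intro x hx hx'
    rw [mem_interior_pinwheelFace] at hx hx'
    fin_cases i <;> norm_num [pinwheelFace, area] at hx <;> fin_cases j <;> first
      | exact hij rfl
      | (norm_num [pinwheelFace, area] at hx'; linarith)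
  · rw [convexHull_triangle harea]
    rintro x ⟨⟨h1, h2⟩, h3⟩
    simp only [Set.mem_ofPred_eq] at h1 h2 h3
    norm_num [area] at h1 h2 h3
    exact pinwheelFrame_cover (by linarith) (by linarith) (by linarith)

/-! ### Finding a drawing on which the algorithm is slow -/

/-- There is a convex subdivision with between `k` and `24 k` vertices on which the
algorithm needs at least `k ^ 2` expected steps between some two vertices. -/
def MemorylessAlgorithm.HasSlowGraph (A : MemorylessAlgorithm) (k : ℕ) : Prop :=
  ∃ G : GeometricGraph, G.IsConvexSubdivision ∧ k ≤ G.verts.card ∧ G.verts.card ≤ 24 * k ∧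
    ∃ s ∈ G.verts, ∃ t ∈ G.verts, ENNReal.ofReal ((k : ℝ) ^ 2) ≤ A.expectedSteps G s t

variable {A : MemorylessAlgorithm} {k : ℕ}

open Classical in
/-- The sides in `arm` are divided into `k` edges, the others are edges. If, after a linear change
of coordinates, all arms are slow and they separate `S` from the origin, then the resulting graph
is slow. -/
lemma Frame.Proper.hasSlowGraph {ι : Type} [Fintype ι] {F : Frame ι} (h : F.Proper)
    (hF : HasConvexFaces F.carrier) (hι : Fintype.card ι ≤ 12) (hk : 0 < k) (e : Plane ≃L[ℝ] Plane)
    (arm : ι → Prop) {i : ι} (hi : arm i) (S : Set Plane)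
    (hside : ∀ i, (¬ arm i ∧ (F.src i ∈ S ↔ F.tgt i ∈ S)) ∨
      (arm i ∧ F.src i ∈ S ∧ F.tgt i ∉ S ∧ A.SlowArm 0 k (e (F.src i)) (e (F.tgt i))))
    {i₀ : ι} (ht : F.src i₀ = 0) (htS : (0 : Plane) ∉ S) {i₁ : ι} (hs : F.src i₁ ∈ S) :
    A.HasSlowGraph k := by
  set n : ι → ℕ := fun i => if arm i then k else 1 with hn_def
  have hn : ∀ i, 0 < n i := fun i => by
    simp only [hn_def]
    split_ifs <;> omega
  have hnk : ∀ i, n i ≤ k := fun i => by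
    simp only [hn_def]
    split_ifs <;> omega
  have hp := h.map e
  have ht' : (F.map e).src i₀ = 0 := by
    change e (F.src i₀) = 0
    rw [ht, map_zero]
  have hsrc_mem : ∀ i, (F.map e).src i ∈ ((F.map e).toGraph n).verts := fun i => by
    simpa only [Frame.node_zero] using
      Frame.node_mem_verts (F := F.map e) (n := n) (i := i) (Nat.zero_le _)
  refine ⟨(F.map e).toGraph n, hp.isConvexSubdivision hn ?_, ?_, ?_, (F.map e).src i₁,
    hsrc_mem i₁, 0, ht' ▸ hsrc_mem i₀, ?_⟩
  · rw [Frame.carrier_map]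
    exact hF.image e
  · have := hp.lt_card_verts (hn i)
    rw [show n i = k from if_pos hi] at this
    exact this.le
  · calc ((F.map e).toGraph n).verts.card ≤ Fintype.card ι * (k + 1) := Frame.card_verts_le hnk
      _ ≤ 12 * (k + 1) := Nat.mul_le_mul_right _ hι
      _ ≤ 24 * k := by omega
  · have hmem : ∀ x, e x ∈ e '' S ↔ x ∈ S := fun x => e.injective.mem_set_image
    refine hp.ofReal_sq_le_expectedSteps A hn (e '' S) (fun i => ?_) ht' ?_ ((hmem _).2 hs)
    · change (n i = 1 ∧ (e (F.src i) ∈ e '' S ↔ e (F.tgt i) ∈ e '' S)) ∨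
        (n i = k ∧ e (F.src i) ∈ e '' S ∧ e (F.tgt i) ∉ e '' S ∧
          A.SlowArm 0 k (e (F.src i)) (e (F.tgt i)))
      rw [hmem, hmem]
      exact (hside i).imp (fun h => ⟨if_neg h.1, h.2⟩) fun h => ⟨if_pos h.1, h.2⟩
    · rw [← map_zero e, hmem]
      exact htS

lemma pt_zero : pt 0 0 = 0 := plane_ext rfl rfl

/-- Two collinear arms on a line missing the origin that are slow when left at their inner ends. -/
lemma hasSlowGraph_triangle (hk : 0 < k) (e : Plane ≃L[ℝ] Plane)
    (h0 : A.SlowArm 0 k (e (pt 1 0)) (e (pt 2 (-1))))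
    (h1 : A.SlowArm 0 k (e (pt 0 1)) (e (pt (-1) 2))) : A.HasSlowGraph k := by
  refine triangleFrame_proper.hasSlowGraph triangleFrame_hasConvexFaces (by simp) hk e
    (fun i => i = 0 ∨ i = 2) (i := 0) (Or.inl rfl) {x | 0 ≤ x 0 ∧ 0 ≤ x 1 ∧ 0 < x 0 + x 1} ?_
    (i₀ := 4) pt_zero (by simp) (i₁ := 0) (by norm_num [triangleFrame])
  intro i
  fin_cases i
  · exact Or.inr ⟨Or.inl rfl, by norm_num [triangleFrame], by norm_num [triangleFrame], h0⟩
  · exact Or.inl ⟨by decide, by norm_num [triangleFrame]⟩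
  · exact Or.inr ⟨Or.inr rfl, by norm_num [triangleFrame], by norm_num [triangleFrame], h1⟩
  · exact Or.inl ⟨by decide, by norm_num [triangleFrame]⟩
  · exact Or.inl ⟨by decide, by norm_num [triangleFrame]⟩

/-- Two arms on neighbouring lines that are slow when left at their outer ends. -/
lemma hasSlowGraph_pentagon (hk : 0 < k) (e : Plane ≃L[ℝ] Plane)
    (h0 : A.SlowArm 0 k (e (pt 3 1)) (e (pt 1 0)))
    (h1 : A.SlowArm 0 k (e (pt 1 3)) (e (pt 0 1))) : A.HasSlowGraph k := by
  refine pentagonFrame_proper.hasSlowGraph pentagonFrame_hasConvexFaces (by simp) hk e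
    (fun i => i = 0 ∨ i = 2) (i := 0) (Or.inl rfl) {x | 2 < x 0 + x 1} ?_
    (i₀ := 4) pt_zero (by simp) (i₁ := 0) (by norm_num [pentagonFrame])
  intro i
  fin_cases i
  · exact Or.inr ⟨Or.inl rfl, by norm_num [pentagonFrame], by norm_num [pentagonFrame], h0⟩
  · exact Or.inl ⟨by decide, by norm_num [pentagonFrame]⟩
  · exact Or.inr ⟨Or.inr rfl, by norm_num [pentagonFrame], by norm_num [pentagonFrame], h1⟩
  · exact Or.inl ⟨by decide, by norm_num [pentagonFrame]⟩
  · exact Or.inl ⟨by decide, by norm_num [pentagonFrame]⟩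

/-- The three arms of a pinwheel that are slow when left at their outer ends. -/
lemma hasSlowGraph_pinwheel (hk : 0 < k) (e : Plane ≃L[ℝ] Plane)
    (h0 : A.SlowArm 0 k (e (pt 3 1)) (e (pt 1 0)))
    (h1 : A.SlowArm 0 k (e (pt (-1) 2)) (e (pt 0 1)))
    (h2 : A.SlowArm 0 k (e (pt (-2) (-3))) (e (pt (-1) (-1)))) : A.HasSlowGraph k := by
  refine pinwheelFrame_proper.hasSlowGraph pinwheelFrame_hasConvexFaces (by simp) hk e
    (fun i => i < 3) (i := 0) (by decide) {x | 2 < x 0 ^ 2 + x 1 ^ 2} ?_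
    (i₀ := 9) pt_zero (by norm_num) (i₁ := 0) (by norm_num [pinwheelFrame])
  intro i
  fin_cases i
  · exact Or.inr ⟨by decide, by norm_num [pinwheelFrame], by norm_num [pinwheelFrame], h0⟩
  · exact Or.inr ⟨by decide, by norm_num [pinwheelFrame], by norm_num [pinwheelFrame], h1⟩
  · exact Or.inr ⟨by decide, by norm_num [pinwheelFrame], by norm_num [pinwheelFrame], h2⟩
  all_goals exact Or.inl ⟨by decide, by norm_num [pinwheelFrame]⟩

/-- The linear map of order three that permutes the arms of the pinwheel cyclically. -/
noncomputable def rotation : Plane ≃L[ℝ] Plane :=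
  LinearEquiv.toContinuousLinearEquiv
    { toFun := fun x => pt (-x 1) (x 0 - x 1)
      invFun := fun x => pt (x 1 - x 0) (-x 0)
      map_add' := fun x y => by refine plane_ext ?_ ?_ <;> simp <;> ring
      map_smul' := fun c x => by
        refine plane_ext ?_ ?_ <;> simp
        ring
      left_inv := fun x => by refine plane_ext ?_ ?_ <;> simp
      right_inv := fun x => by refine plane_ext ?_ ?_ <;> simp }

/-- The reflection that exchanges the coordinates. It maps the pinwheel to its mirror image. -/
noncomputable def reflection : Plane ≃L[ℝ] Plane :=
  LinearEquiv.toContinuousLinearEquiv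
    { toFun := fun x => pt (x 1) (x 0)
      invFun := fun x => pt (x 1) (x 0)
      map_add' := fun x y => by refine plane_ext ?_ ?_ <;> simp
      map_smul' := fun c x => by refine plane_ext ?_ ?_ <;> simp
      left_inv := fun x => by refine plane_ext ?_ ?_ <;> simp
      right_inv := fun x => by refine plane_ext ?_ ?_ <;> simp }

lemma rotation_pt (a b : ℝ) : rotation (pt a b) = pt (-b) (a - b) := rfl

lemma reflection_pt (a b : ℝ) : reflection (pt a b) = pt b a := rfl

lemma slowArm_pt_or (hk : 0 < k) (a b c d : ℝ) (h : a * d - b * c ≠ 0) :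
    A.SlowArm 0 k (pt a b) (pt c d) ∨ A.SlowArm 0 k (pt c d) (pt a b) := by
  refine A.slowArm_or_slowArm_symm hk ?_ ?_
  · intro he
    have h0 : a = c := congrArg (fun v : Plane => v 0) he
    have h1 : b = d := congrArg (fun v : Plane => v 1) he
    subst h0 h1
    exact h (by ring)
  · intro hmem
    have h1 := (area_of_mem_segment hmem).1
    refine h ?_
    simp [area] at h1
    linarith

/-- If the pinwheel fails, one of its arms is slow when left at the inner end; the triangles
and pentagons propagate this around the origin until all arms of the mirror image are seen to be
slow when left at their outer ends. -/
theorem MemorylessAlgorithm.hasSlowGraph (A : MemorylessAlgorithm) (hk : 0 < k) :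
    A.HasSlowGraph k := by
  have d0 := slowArm_pt_or (A := A) hk 1 0 3 1 (by norm_num)
  have d1 := slowArm_pt_or (A := A) hk 0 1 (-1) 2 (by norm_num)
  have d2 := slowArm_pt_or (A := A) hk (-1) (-1) (-2) (-3) (by norm_num)
  have m0 := slowArm_pt_or (A := A) hk 1 0 2 (-1) (by norm_num)
  have m1 := slowArm_pt_or (A := A) hk 0 1 1 3 (by norm_num)
  have m2 := slowArm_pt_or (A := A) hk (-1) (-1) (-3) (-2) (by norm_num)
  have t0 := hasSlowGraph_triangle (A := A) hk (ContinuousLinearEquiv.refl ℝ Plane)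
  have t1 := hasSlowGraph_triangle (A := A) hk rotation
  have t2 := hasSlowGraph_triangle (A := A) hk (rotation.trans rotation)
  have p0 := hasSlowGraph_pentagon (A := A) hk (ContinuousLinearEquiv.refl ℝ Plane)
  have p1 := hasSlowGraph_pentagon (A := A) hk rotation
  have p2 := hasSlowGraph_pentagon (A := A) hk (rotation.trans rotation)
  have w := hasSlowGraph_pinwheel (A := A) hk (ContinuousLinearEquiv.refl ℝ Plane)
  have w' := hasSlowGraph_pinwheel (A := A) hk reflection
  simp only [ContinuousLinearEquiv.trans_apply, ContinuousLinearEquiv.coe_refl', id_eq,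
    rotation_pt, reflection_pt] at t0 t1 t2 p0 p1 p2 w w'
  norm_num only at d0 d1 d2 m0 m1 m2 t0 t1 t2 p0 p1 p2 w w'
  by_contra hG
  -- With `I`, `O` for slow when left at the inner, outer end: if an arm of the pinwheel has `I`,
  -- the triangle forces `O` on the collinear mirrored arm, and the pentagon `I` on the next arm.
  have chain : ∀ {I I' O I'' O'' : Prop}, (I' → I → A.HasSlowGraph k) → I' ∨ O →
      (O'' → O → A.HasSlowGraph k) → I'' ∨ O'' → I → O ∧ I'' := by
    intro I I' O I'' O'' ht hm hp hd hI
    have hO := hm.resolve_left fun hI' => hG (ht hI' hI)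
    exact ⟨hO, hd.resolve_right fun hO'' => hG (hp hO'' hO)⟩
  have c0 := chain t2 m2 p1 d1
  have c1 := chain t0 m0 p2 d2
  have c2 := chain t1 m1 p0 d0
  have key := fun h => hG (w' (c2 (c1 (c0 h).2).2).1 (c1 (c0 h).2).1 (c0 h).1)
  rcases d0 with i0 | o0
  · exact key i0
  rcases d1 with i1 | o1
  · exact key (c2 (c1 i1).2).2
  rcases d2 with i2 | o2
  · exact key (c2 i2).2
  · exact hG (w o0 o1 o2)

end GeoRouting

theorem theorem3p1 :
    ∃ c c₁ c₂ : ℝ, 0 < c ∧ 0 < c₁ ∧ 0 < c₂ ∧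
      ∀ (A : GeoRouting.MemorylessAlgorithm) (k : ℕ), 0 < k →
        ∃ G : GeoRouting.GeometricGraph, G.IsConvexSubdivision ∧
          c₁ * (k : ℝ) ≤ (G.verts.card : ℝ) ∧ (G.verts.card : ℝ) ≤ c₂ * (k : ℝ) ∧
          ∃ s ∈ G.verts, ∃ t ∈ G.verts,
            ENNReal.ofReal (c * (k : ℝ) ^ 2) ≤ A.expectedSteps G s t := by
  refine ⟨1, 1, 24, one_pos, one_pos, by norm_num, fun A k hk => ?_⟩
  obtain ⟨G, hG, h1, h2, s, hs, t, ht, h⟩ := A.hasSlowGraph hk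
  refine ⟨G, hG, ?_, by exact_mod_cast h2, s, hs, t, ht, by rwa [one_mul]⟩
  rw [one_mul]
  exact_mod_cast h1
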